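/- Let $M=(E,\mathcal I)$ be a matroid of rank $r$ on a finite ground set $E$, let $w:E\to\mathbb R$ be a weight function, and let $E_0\subseteq E$ be a subset that contains a basis of $M$. For $A\subseteq E\setminus E_0$ let \[f(A)=\min\{w(X)\ :\ X\subseteq E_0\cup A\text{ is a basis of }M\},\qquad w(X)=\sum_{x\in X}w(x),\] and let $T=|E\setminus E_0|$. The incremental matroid design problem with minimum weight bases (IMD-MWB) is the optimization problem \[\min\Big\{\sum_{i=0}^T f(A_i)\ :\ A_0,\dots,A_T\subseteq E\setminus E_0,\ A_0=\emptyset,\ |A_i\setminus A_{i-1}|=1\text{ for }i=1,\dots,T\Big\}.\] Theorem. Relative to an independence oracle for the matroid, the problem IMD-MWB can be solved in time \[O\big(\max\{|E|+r^2,\ |E|\log|E|\}\big).\] That is, there are one program and one constant $C$ such that on every instance $(M,E_0,w)$ with $E=\{0,\dots,n-1\}$ the program halts after at most $C\max\{1,\ n+r^2,\ n\log n\}$ steps (the $1$ matters only for $n=0$) and outputs an ordering $e'_1,\dots,e'_T$ of $E\setminus E_0$ for which the sets $A_i=\{e'_1,\dots,e'_i\}$, $i=0,\dots,T$, are an optimal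 solution of IMD-MWB. Here a program is a finite program for a random access machine with integer and real registers and arrays, in which each of the following takes one step: addition or (on integers, truncated) subtraction, comparison, copying or setting of a constant, indirect access to an array entry, and a query to the independence oracle on the set whose characteristic vector is stored in a given array. The input consists of $n$, the characteristic vector of $E_0$ and the array of weights, in no particular order; the program has access to $M$ only through the oracle. -/

import Mathlib

namespace IMD

/-! ### The optimization problem -/

section Problem

variable {α : Type*} [DecidableEq α]

/-- `f(A) = min {w(X) : X ⊆ E₀ ∪ A is a basis of M}`.  The set of weights is finite when the ground
set is finite, and nonempty when `E₀` contains a basis, so that the infimum is a minimum. -/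
noncomputable def minBaseWeight (M : Matroid α) (E₀ : Finset α) (w : α → ℝ) (A : Finset α) : ℝ :=
  sInf {c : ℝ | ∃ X : Finset α, M.IsBase (X : Set α) ∧ X ⊆ E₀ ∪ A ∧ c = ∑ x ∈ X, w x}

/-- The time horizon `T = |E \ E₀|`. -/
noncomputable def horizon (M : Matroid α) (E₀ : Finset α) : ℕ :=
  (M.E \ (E₀ : Set α)).ncard

/-- The sequence `A₀, …, A_T` of subsets of `E \ E₀` is feasible: `A₀ = ∅`, and `|Aᵢ \ Aᵢ₋₁| = 1`
for `i = 1, …, T`. Only the values of `A` at `0, …, T` matter. -/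
def Feasible (M : Matroid α) (E₀ : Finset α) (A : ℕ → Finset α) : Prop :=
  (∀ i ≤ horizon M E₀, (A i : Set α) ⊆ M.E \ (E₀ : Set α)) ∧
    A 0 = ∅ ∧ ∀ i < horizon M E₀, (A (i + 1) \ A i).card = 1

/-- The objective value `f(A₀) + ⋯ + f(A_T)`. -/
noncomputable def objective (M : Matroid α) (E₀ : Finset α) (w : α → ℝ) (A : ℕ → Finset α) : ℝ :=
  ∑ i ∈ Finset.range (horizon M E₀ + 1), minBaseWeight M E₀ w (A i)

/-- `A₀, …, A_T` is an optimal solution of the incremental matroid design problem with minimum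
weight bases. -/
def IsOptimalSolution (M : Matroid α) (E₀ : Finset α) (w : α → ℝ) (A : ℕ → Finset α) : Prop :=
  Feasible M E₀ A ∧ ∀ B, Feasible M E₀ B → objective M E₀ w A ≤ objective M E₀ w B

end Problem

/-! ### The machine model

A random access machine with integer registers and arrays (addition, subtraction, comparison and
indirect addressing), real registers and arrays (addition, subtraction and comparison only, and no
conversion between reals and integers), and an independence oracle. A program is a fixed finite text,
so it names finitely many registers and arrays. Every instruction, every test and every oracle call
takes one unit of time. -/

/-- A memory configuration. -/
structure State where
  /-- integer registers -/
  reg : ℕ → ℕ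
  /-- integer arrays: `arr a i` is the entry of index `i` of array `a` -/
  arr : ℕ → ℕ → ℕ
  /-- real registers -/
  rreg : ℕ → ℝ
  /-- real arrays -/
  rarr : ℕ → ℕ → ℝ

/-- Elementary instructions. -/
inductive Instr where
  /-- `reg d ← c` for a literal `c` -/
  | const (d c : ℕ)
  /-- `reg d ← reg s` -/
  | copy (d s : ℕ)
  /-- `reg d ← reg s + reg t` -/
  | add (d s t : ℕ)
  /-- `reg d ← max (reg s - reg t) 0` -/
  | sub (d s t : ℕ)
  /-- `reg d ← arr a [reg i]` -/
  | load (d a i : ℕ)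
  /-- `arr a [reg i] ← reg s` -/
  | store (a i s : ℕ)
  /-- `rreg d ← rreg s` -/
  | rcopy (d s : ℕ)
  /-- `rreg d ← rreg s + rreg t` -/
  | radd (d s t : ℕ)
  /-- `rreg d ← rreg s - rreg t` -/
  | rsub (d s t : ℕ)
  /-- `rreg d ← rarr a [reg i]` -/
  | rload (d a i : ℕ)
  /-- `rarr a [reg i] ← rreg s` -/
  | rstore (a i s : ℕ)

/-- Elementary tests. -/
inductive Test where
  /-- `reg s < reg t` -/
  | lt (s t : ℕ)
  /-- `reg s = reg t` -/
  | eq (s t : ℕ)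
  /-- `rreg s < rreg t` -/
  | rlt (s t : ℕ)
  /-- oracle call: is the set whose characteristic vector is stored in array `a` independent? -/
  | indep (a : ℕ)

/-- Programs. -/
inductive Prog where
  | skip
  | instr (c : Instr)
  | seq (p q : Prog)
  | ite (b : Test) (p q : Prog)
  | loop (b : Test) (p : Prog)

/-- The effect of an instruction. -/
noncomputable def Instr.apply (s : State) : Instr → State
  | .const d c => { s with reg := Function.update s.reg d c }
  | .copy d i => { s with reg := Function.update s.reg d (s.reg i) }
  | .add d i j => { s with reg := Function.update s.reg d (s.reg i + s.reg j) }
  | .sub d i j => { s with reg := Function.update s.reg d (s.reg i - s.reg j) }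
  | .load d a i => { s with reg := Function.update s.reg d (s.arr a (s.reg i)) }
  | .store a i j =>
      { s with arr := Function.update s.arr a (Function.update (s.arr a) (s.reg i) (s.reg j)) }
  | .rcopy d i => { s with rreg := Function.update s.rreg d (s.rreg i) }
  | .radd d i j => { s with rreg := Function.update s.rreg d (s.rreg i + s.rreg j) }
  | .rsub d i j => { s with rreg := Function.update s.rreg d (s.rreg i - s.rreg j) }
  | .rload d a i => { s with rreg := Function.update s.rreg d (s.rarr a (s.reg i)) }
  | .rstore a i j =>
      { s with rarr := Function.update s.rarr a (Function.update (s.rarr a) (s.reg i) (s.rreg j)) }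

/-- The outcome of a test, for the independence oracle of a matroid `M` whose ground set is
labelled by `0, …, n - 1`. -/
def Test.Holds {n : ℕ} (M : Matroid (Fin n)) (s : State) : Test → Prop
  | .lt i j => s.reg i < s.reg j
  | .eq i j => s.reg i = s.reg j
  | .rlt i j => s.rreg i < s.rreg j
  | .indep a => M.Indep {e : Fin n | s.arr a e ≠ 0}

/-- `Exec M p s t s'`: started in configuration `s`, the program `p` with the independence oracle of
`M` halts after exactly `t` units of time, in configuration `s'`. -/
inductive Exec {n : ℕ} (M : Matroid (Fin n)) : Prog → State → ℕ → State → Prop where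
  | skip (s : State) : Exec M .skip s 0 s
  | instr (c : Instr) (s : State) : Exec M (.instr c) s 1 (c.apply s)
  | seq {p q : Prog} {s s' s'' : State} {t u : ℕ} :
      Exec M p s t s' → Exec M q s' u s'' → Exec M (.seq p q) s (t + u) s''
  | ite_true {b : Test} {p q : Prog} {s s' : State} {t : ℕ} :
      b.Holds M s → Exec M p s t s' → Exec M (.ite b p q) s (t + 1) s'
  | ite_false {b : Test} {p q : Prog} {s s' : State} {t : ℕ} :
      ¬ b.Holds M s → Exec M q s t s' → Exec M (.ite b p q) s (t + 1) s'
  | loop_true {b : Test} {p : Prog} {s s' s'' : State} {t u : ℕ} :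
      b.Holds M s → Exec M p s t s' → Exec M (.loop b p) s' u s'' →
        Exec M (.loop b p) s (t + u + 1) s''
  | loop_false {b : Test} {p : Prog} {s : State} :
      ¬ b.Holds M s → Exec M (.loop b p) s 1 s

open Classical in
/-- The input: register `0` holds `n = |E|`, integer array `0` the characteristic vector of `E₀`, and
real array `0` the weights (in the arbitrary order in which the elements are labelled). All other
registers and entries are zero. -/
noncomputable def inputState {n : ℕ} (E₀ : Finset (Fin n)) (w : Fin n → ℝ) : State where
  reg k := if k = 0 then n else 0
  arr a i := if a = 0 ∧ ∃ e ∈ E₀, (e : ℕ) = i then 1 else 0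
  rreg _ := 0
  rarr a i := if h : a = 0 ∧ i < n then w ⟨i, h.2⟩ else 0

/-- The output: the entries `e'₁, e'₂, …` of integer array `1` are read as the order in which
elements are added, so that `Aᵢ = {e'₁, …, e'ᵢ}`. -/
def outputSets {n : ℕ} (s : State) (i : ℕ) : Finset (Fin n) :=
  Finset.univ.filter fun e => ∃ j < i, s.arr 1 j = (e : ℕ)

end IMD

/-! Write `G` for `E₀` and order the elements by weight. Let `X` be the greedy basis of `G`, and let
`f 0, …, f (m - 1)` be the elements outside `G` of the greedy basis of the whole matroid, in that
order. Swap them into `X` one after the other, each for the last element `e i` of `X` whose removal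
leaves an independent set. The gain of swap `i` is `w (e i) - w (f i) ≥ 0`.

The heart of the proof is that, for every `k` at once, a cheapest basis with at most `k` elements
outside `G` weighs `w(X)` minus the `k` largest gains (or all gains, if `k ≥ m`), and that such a
basis uses only the corresponding elements `f i`. Adding elements by decreasing gain, and the
remaining ones afterwards, therefore minimizes every term of the objective separately, because a
feasible `A i` has at most `i` elements.

Upper bound (`exists_isBase_of_subset`): any set of swaps can be carried out together without losing
gain. By `f_notMem_closure`, even in another basis, `f i` can replace some element of `G` at least
as late as `e i`.

Lower bound (`le_penalized_weight`): charge `c` for each element outside `G`. The set obtained by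
the swaps of gain above `c` then spans every element by elements that are no heavier, so no basis is
cheaper. With the `k+1`-st largest gain as the multiplier `c`, the two bounds meet in
`exists_isBase_sum_le`.

Time: merge sort takes `O(n log n)` steps, the two greedy scans and the output `O(n)`, and the at
most `r` exchanges, each of which tries at most `r` elements, `O(r²)`. Sorting the gains costs no
more than sorting `E`. -/

namespace IMD

open Set

/-! ### Successive exchanges in the greedy basis of `G` -/

section Exchange

variable {α : Type*}

/-- `X` is the basis of `U` that the greedy algorithm finds for the order given by `pos`. -/
structure IsGreedyBasis (M : Matroid α) (pos : α → ℕ) (U X : Set α) : Prop where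
  indep : M.Indep X
  subset : X ⊆ U
  span : ∀ x ∈ U, x ∈ M.closure {y | y ∈ X ∧ pos y ≤ pos x}

/-- The basis obtained from `X` by exchanging `e j` for `f j` for all `j < i`. -/
def exchanged (X : Set α) (e f : ℕ → α) (i : ℕ) : Set α :=
  (X \ e '' Iio i) ∪ f '' Iio i

/-- The elements `f 0, …, f (m - 1)` outside `G` of the greedy basis of the matroid are swapped
successively into the greedy basis `X` of `G`, each for the last possible element `e i` of `X`. -/
structure IsSwapSequence (M : Matroid α) (pos : α → ℕ) (G X : Set α) (e f : ℕ → α) (m : ℕ) :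
    Prop where
  injOn_pos : InjOn pos M.E
  subset_ground : G ⊆ M.E
  isBase : M.IsBase X
  greedy : IsGreedyBasis M pos G X
  f_notMem : ∀ i < m, f i ∉ G
  f_indep : M.Indep (f '' Iio m)
  f_mono : ∀ i j, i < j → j < m → pos (f i) < pos (f j)
  f_free : ∀ i < m, f i ∉ M.closure {y | (y ∈ G ∨ y ∈ f '' Iio m) ∧ pos y < pos (f i)}
  span : ∀ x ∈ M.E, x ∉ G → x ∉ f '' Iio m →
    x ∈ M.closure {y | (y ∈ G ∨ y ∈ f '' Iio m) ∧ pos y < pos x}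
  e_mem : ∀ i < m, e i ∈ X
  e_indep : ∀ i < m, M.Indep (insert (f i) (exchanged X e f i) \ {e i})
  e_max : ∀ i < m, ∀ y ∈ X, M.Indep (insert (f i) (exchanged X e f i) \ {y}) → pos y ≤ pos (e i)

variable {M : Matroid α} {pos : α → ℕ} {G X : Set α} {e f : ℕ → α} {m : ℕ}

theorem exchanged_zero (X : Set α) (e f : ℕ → α) : exchanged X e f 0 = X := by
  simp [exchanged]

/-- The right-hand side removes `e i` after all insertions, whereas `exchanged` removes before it
inserts. The two agree because `e i` is none of the inserted elements. -/
theorem exchanged_succ {i : ℕ} (hne : ∀ j ≤ i, f j ≠ e i) :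
    exchanged X e f (i + 1) = insert (f i) (exchanged X e f i) \ {e i} := by
  ext y
  simp only [exchanged, mem_union, mem_sdiff, mem_image, mem_Iio, mem_insert_iff,
    mem_singleton_iff, Nat.lt_succ_iff_lt_or_eq]
  constructor
  · rintro (⟨hy, hy'⟩ | ⟨j, hj | rfl, rfl⟩)
    · exact ⟨Or.inr (Or.inl ⟨hy, fun ⟨j, hj, hjy⟩ => hy' ⟨j, Or.inl hj, hjy⟩⟩),
        fun hye => hy' ⟨i, Or.inr rfl, hye.symm⟩⟩
    · exact ⟨Or.inr (Or.inr ⟨j, hj, rfl⟩), hne j hj.le⟩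
    · exact ⟨Or.inl rfl, hne j le_rfl⟩
  · rintro ⟨rfl | ⟨hy, hy'⟩ | ⟨j, hj, rfl⟩, hye⟩
    · exact Or.inr ⟨i, Or.inr rfl, rfl⟩
    · left
      refine ⟨hy, ?_⟩
      rintro ⟨j, hj | rfl, hjy⟩
      · exact hy' ⟨j, hj, hjy⟩
      · exact hye hjy.symm
    · exact Or.inr ⟨j, Or.inl hj, rfl⟩

theorem exchanged_congr {e' : ℕ → α} {i : ℕ} (he : ∀ j < i, e j = e' j) :
    exchanged X e f i = exchanged X e' f i := by
  have himage : e '' Iio i = e' '' Iio i := image_congr fun j hj => he j hj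
  rw [exchanged, exchanged, himage]

namespace IsSwapSequence

variable (h : IsSwapSequence M pos G X e f m)
include h

theorem f_injOn : InjOn f (Iio m) := by
  intro i hi j hj hij
  rcases lt_trichotomy i j with hlt | heq | hgt
  · exact absurd (h.f_mono i j hlt hj) (by simp [hij])
  · exact heq
  · exact absurd (h.f_mono j i hgt hi) (by simp [hij])

theorem f_mem_ground {i : ℕ} (hi : i < m) : f i ∈ M.E :=
  h.f_indep.subset_ground ⟨i, hi, rfl⟩

theorem e_mem_green {i : ℕ} (hi : i < m) : e i ∈ G := h.greedy.subset (h.e_mem i hi)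

theorem e_ne_f {i j : ℕ} (hi : i < m) (hj : j < m) : e i ≠ f j :=
  fun heq => h.f_notMem j hj (heq ▸ h.e_mem_green hi)

theorem f_notMem_exchanged {i : ℕ} (hi : i < m) : f i ∉ exchanged X e f i := by
  rintro (⟨hx, -⟩ | ⟨j, hj, hji⟩)
  · exact h.f_notMem i hi (h.greedy.subset hx)
  · have := h.f_injOn (show j < m from lt_trans hj hi) hi hji
    exact absurd hj (by simp [this])

/-- If `e i` had already left, removing it would change nothing, and an independent set would
properly contain a basis. So the search for `e i` may range over all of `X` without choosing an
element twice. -/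
theorem e_mem_exchanged_of_isBase {i : ℕ} (hi : i < m) (hB : M.IsBase (exchanged X e f i)) :
    e i ∈ exchanged X e f i := by
  by_contra hne
  have hind := h.e_indep i hi
  have hf := h.f_notMem_exchanged hi
  rw [sdiff_singleton_eq_self] at hind
  · have := hB.eq_of_subset_indep hind (subset_insert _ _)
    exact hf (this ▸ mem_insert _ _)
  · rintro (h1 | h1)
    · exact h.e_ne_f hi hi h1
    · exact hne h1

theorem isBase_exchanged {i : ℕ} (hi : i ≤ m) : M.IsBase (exchanged X e f i) := by
  induction i with
  | zero => simpa [exchanged_zero] using h.isBase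
  | succ i ih =>
    have hi' : i < m := hi
    have hB := ih hi'.le
    have hf := h.f_notMem_exchanged hi'
    have he := h.e_mem_exchanged_of_isBase hi' hB
    rw [exchanged_succ fun j hj => (h.e_ne_f hi' (lt_of_le_of_lt hj hi')).symm]
    exact hB.exchange_isBase_of_indep' he hf (h.e_indep i hi')

theorem e_mem_exchanged {i : ℕ} (hi : i < m) : e i ∈ exchanged X e f i :=
  h.e_mem_exchanged_of_isBase hi (h.isBase_exchanged hi.le)

theorem e_injOn : InjOn e (Iio m) := by
  have key : ∀ i j, i < j → j < m → e i ≠ e j := by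
    intro i j hij hj heq
    rcases h.e_mem_exchanged hj with ⟨-, h2⟩ | ⟨l, hl, hle⟩
    · exact h2 ⟨i, hij, heq⟩
    · exact h.e_ne_f hj (lt_trans hl hj) hle.symm
  intro i hi j hj hij
  rcases lt_trichotomy i j with hlt | heq | hgt
  · exact absurd hij (key i j hlt hj)
  · exact heq
  · exact absurd hij.symm (key j i hgt hi)

/-- The elements of the fundamental circuit of `f i`. -/
theorem mem_circuit_cases {i : ℕ} (hi : i < m) {y : α}
    (hy : y ∈ M.fundCircuit (f i) (exchanged X e f i)) :
    y ∈ f '' Iic i ∨ (y ∈ X ∧ y ∉ e '' Iio i ∧ pos y ≤ pos (e i)) := by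
  have hB := h.isBase_exchanged hi.le
  have hind := (hB.indep.mem_fundCircuit_iff (by rw [hB.closure_eq]; exact h.f_mem_ground hi)
    (h.f_notMem_exchanged hi)).1 hy
  rcases M.fundCircuit_subset_insert _ _ hy with rfl | ⟨h1, h2⟩ | ⟨j, hj, rfl⟩
  · exact Or.inl ⟨i, mem_Iic.2 le_rfl, rfl⟩
  · exact Or.inr ⟨h1, h2, h.e_max i hi y h1 hind⟩
  · exact Or.inl ⟨j, mem_Iic.2 (mem_Iio.1 hj).le, rfl⟩

theorem isCircuit {i : ℕ} (hi : i < m) :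
    M.IsCircuit (M.fundCircuit (f i) (exchanged X e f i)) :=
  (h.isBase_exchanged hi.le).fundCircuit_isCircuit (h.f_mem_ground hi) (h.f_notMem_exchanged hi)

/-- Since `e i` is the last removable element of `X`, the fundamental circuit of `f i` has no later
element of `X`. Solve this circuit for `f i`. -/
theorem f_mem_closure {i : ℕ} (hi : i < m) :
    f i ∈ M.closure (f '' Iio i ∪ {y | y ∈ X ∧ pos y ≤ pos (e i)}) := by
  refine M.closure_subset_closure ?_ ((h.isCircuit hi).mem_closure_sdiff_singleton_of_mem
    (M.mem_fundCircuit _ _))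
  rintro y ⟨hy, hne⟩
  rcases h.mem_circuit_cases hi hy with ⟨j, hj, rfl⟩ | ⟨h1, -, h2⟩
  · refine Or.inl ⟨j, mem_Iio.2 (lt_of_le_of_ne hj ?_), rfl⟩
    rintro rfl
    exact hne rfl
  · exact Or.inr ⟨h1, h2⟩

/-- The same circuit solved for `e i`: the other elements of `X` in it are still present and come
strictly before `e i`. -/
theorem e_mem_closure {i : ℕ} (hi : i < m) :
    e i ∈ M.closure (f '' Iic i ∪ {y | y ∈ X ∧ y ∉ e '' Iio (i + 1) ∧ pos y < pos (e i)}) := by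
  have hB := h.isBase_exchanged hi.le
  have he : e i ∈ M.fundCircuit (f i) (exchanged X e f i) :=
    (hB.indep.mem_fundCircuit_iff (by rw [hB.closure_eq]; exact h.f_mem_ground hi)
      (h.f_notMem_exchanged hi)).2 (h.e_indep i hi)
  refine M.closure_subset_closure ?_ ((h.isCircuit hi).mem_closure_sdiff_singleton_of_mem he)
  rintro y ⟨hy, hne⟩
  rcases h.mem_circuit_cases hi hy with hj | ⟨h1, h3, h2⟩
  · exact Or.inl hj
  · refine Or.inr ⟨h1, ?_, lt_of_le_of_ne h2 fun hpos => hne (h.injOn_pos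
      (h.isBase.subset_ground h1) (h.isBase.subset_ground (h.e_mem i hi)) hpos)⟩
    rintro ⟨j, hj, hjy⟩
    rcases Nat.lt_succ_iff_lt_or_eq.1 hj with hj | rfl
    · exact h3 ⟨j, hj, hjy⟩
    · exact hne hjy.symm

/-- Otherwise `f_mem_closure` would span `f i` by earlier elements, and the greedy algorithm on the
whole matroid would have rejected it. -/
theorem pos_f_lt_pos_e {i : ℕ} (hi : i < m) : pos (f i) < pos (e i) := by
  by_contra hle
  have hlt : pos (e i) < pos (f i) := lt_of_le_of_ne (not_lt.1 hle) fun hpos =>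
    h.e_ne_f hi hi (h.injOn_pos (h.isBase.subset_ground (h.e_mem i hi)) (h.f_mem_ground hi) hpos)
  refine h.f_free i hi (M.closure_subset_closure ?_ (h.f_mem_closure hi))
  rintro y (⟨j, hj, rfl⟩ | ⟨h1, h2⟩)
  · exact ⟨Or.inr ⟨j, lt_trans hj hi, rfl⟩, h.f_mono j i hj hi⟩
  · exact ⟨Or.inl (h.greedy.subset h1), h2.trans_lt hlt⟩

/-- After `i` exchanges, the remaining elements of `X` still span all of `G` greedily. -/
theorem green_mem_closure {i : ℕ} (hi : i ≤ m) {x : α} (hx : x ∈ G) :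
    x ∈ M.closure (f '' Iio i ∪ {y | y ∈ X ∧ y ∉ e '' Iio i ∧ pos y ≤ pos x}) := by
  induction i with
  | zero =>
    refine M.closure_subset_closure ?_ (h.greedy.span x hx)
    rintro y ⟨h1, h2⟩
    exact Or.inr ⟨h1, by simp, h2⟩
  | succ i ih =>
    have hi' : i < m := hi
    refine M.closure_subset_closure_of_subset_closure ?_ (ih hi'.le)
    have hground : f '' Iio (i + 1) ∪ {y | y ∈ X ∧ y ∉ e '' Iio (i + 1) ∧ pos y ≤ pos x} ⊆ M.E := by
      rintro y (⟨j, hj, rfl⟩ | ⟨h1, -⟩)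
      · exact h.f_mem_ground (lt_of_lt_of_le hj hi)
      · exact h.isBase.subset_ground h1
    rintro y (⟨j, hj, rfl⟩ | ⟨h1, h2, h3⟩)
    · exact M.mem_closure_of_mem (Or.inl ⟨j, Nat.lt_succ_of_lt hj, rfl⟩) hground
    -- Only `e i` has left in this step, and `e_mem_closure` replaces it by inserted elements and
    -- earlier survivors.
    · by_cases hye : y = e i
      · subst hye
        refine M.closure_subset_closure ?_ (h.e_mem_closure hi')
        rintro z (⟨j, hj, rfl⟩ | ⟨h4, h5, h6⟩)
        · exact Or.inl ⟨j, Nat.lt_succ_of_le hj, rfl⟩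
        · exact Or.inr ⟨h4, h5, h6.le.trans h3⟩
      · refine M.mem_closure_of_mem (Or.inr ⟨h1, ?_, h3⟩) hground
        rintro ⟨j, hj, hjy⟩
        rcases Nat.lt_succ_iff_lt_or_eq.1 hj with hj | rfl
        · exact h2 ⟨j, hj, hjy⟩
        · exact hye hjy.symm

/-- By `green_mem_closure`, all of these elements are spanned by the current basis without `e i`. If
they spanned `f i`, exchanging `e i` for `f i` would not leave an independent set. The statement no
longer mentions the current basis, so it can be applied to circuits in other bases. -/
theorem f_notMem_closure {i : ℕ} (hi : i < m) :
    f i ∉ M.closure (f '' Iio i ∪ {y | y ∈ G ∧ pos y < pos (e i)}) := by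
  intro hf
  have hB := h.isBase_exchanged hi.le
  have hne := h.f_notMem_exchanged hi
  have hind := h.e_indep i hi
  rw [← insert_sdiff_singleton_comm (h.e_ne_f hi hi).symm,
    (hB.indep.sdiff {e i}).insert_indep_iff_of_notMem fun hc => hne hc.1] at hind
  refine hind.2 (M.closure_subset_closure_of_subset_closure ?_ hf)
  rintro y (⟨j, hj, rfl⟩ | ⟨h1, h2⟩)
  · exact M.mem_closure_of_mem ⟨Or.inr ⟨j, hj, rfl⟩, (h.e_ne_f hi (lt_trans hj hi)).symm⟩
      (sdiff_subset.trans hB.subset_ground)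
  · refine M.closure_subset_closure ?_ (h.green_mem_closure hi.le h1)
    rintro z (⟨j, hj, rfl⟩ | ⟨h4, h5, h6⟩)
    · exact ⟨Or.inr ⟨j, hj, rfl⟩, (h.e_ne_f hi (lt_trans hj hi)).symm⟩
    · refine ⟨Or.inl ⟨h4, h5⟩, ?_⟩
      rintro rfl
      omega

end IsSwapSequence

end Exchange

/-! ### Comparing weights through level sets -/

/-- Delete a heaviest element from each set. The count at the level of the heaviest element of `X`
forces all of `B` to lie at or below that level, so the two deleted elements compare in the right
direction. -/
theorem sum_le_sum_of_forall_card_le {α : Type*} (v : α → ℝ) :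
    ∀ (X B : Finset α), B.card = X.card →
      (∀ t, (X.filter fun x => v x ≤ t).card ≤ (B.filter fun x => v x ≤ t).card) →
      ∑ x ∈ B, v x ≤ ∑ x ∈ X, v x := by
  classical
  intro X
  induction hn : X.card generalizing X with
  | zero =>
    intro B hB _
    rw [Finset.card_eq_zero] at hn hB
    simp [hn, hB]
  | succ k ih =>
    intro B hB hcount
    obtain ⟨x, hx, hxmax⟩ := X.exists_max_image v (Finset.card_pos.1 (by omega))
    obtain ⟨b, hb, hbmax⟩ := B.exists_max_image v (Finset.card_pos.1 (by omega))
    have hXk : (X.erase x).card = k := by rw [Finset.card_erase_of_mem hx, hn]; rfl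
    have hBk : (B.erase b).card = k := by rw [Finset.card_erase_of_mem hb, hB]; rfl
    have hbx : v b ≤ v x := by
      have h1 := hcount (v x)
      rw [Finset.filter_true_of_mem hxmax, hn, ← hB] at h1
      have h2 := Finset.eq_of_subset_of_card_le (Finset.filter_subset _ B) h1
      rw [← h2] at hb
      exact (Finset.mem_filter.1 hb).2
    rw [← Finset.add_sum_erase _ _ hx, ← Finset.add_sum_erase _ _ hb]
    refine add_le_add hbx (ih _ hXk _ hBk fun t => ?_)
    -- From the level of `b` upwards all of `B.erase b` is counted; below that level the deletion of
    -- `b` changes no count.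
    by_cases ht : v b ≤ t
    · rw [Finset.filter_true_of_mem (s := B.erase b)
        fun y hy => (hbmax y (Finset.mem_of_mem_erase hy)).trans ht, hBk, ← hXk]
      exact Finset.card_filter_le _ _
    · calc ((X.erase x).filter fun x => v x ≤ t).card
          ≤ (X.filter fun x => v x ≤ t).card :=
            Finset.card_le_card (Finset.filter_subset_filter _ (Finset.erase_subset _ _))
        _ ≤ _ := hcount t
        _ ≤ _ := by
            refine Finset.card_le_card fun y hy => ?_
            rw [Finset.mem_filter] at hy ⊢
            refine ⟨Finset.mem_erase.2 ⟨?_, hy.1⟩, hy.2⟩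
            rintro rfl
            exact ht hy.2

/-- A set that spans every element of an independent set by elements of at most the same weight
has at most the weight of that set, if it is not larger. -/
theorem sum_le_sum_of_mem_closure {α : Type*} {M : Matroid α} (v : α → ℝ) {B X : Finset α}
    (hX : M.Indep (X : Set α)) (hcard : B.card ≤ X.card)
    (hspan : ∀ x ∈ X, x ∈ M.closure {b | b ∈ B ∧ v b ≤ v x}) :
    ∑ x ∈ B, v x ≤ ∑ x ∈ X, v x := by
  -- The part of `X` up to level `t` is independent and spanned by the part of `B` up to level `t`;
  -- compare ranks.
  have key : ∀ t, (X.filter fun x => v x ≤ t).card ≤ (B.filter fun x => v x ≤ t).card := by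
    intro t
    have h1 : M.Indep ((X.filter fun x => v x ≤ t : Finset α) : Set α) :=
      hX.subset (Finset.coe_subset.2 (Finset.filter_subset _ _))
    have h2 : ((X.filter fun x => v x ≤ t : Finset α) : Set α) ⊆
        M.closure ((B.filter fun x => v x ≤ t : Finset α) : Set α) := by
      intro x hx
      rw [Finset.mem_coe, Finset.mem_filter] at hx
      refine M.closure_subset_closure ?_ (hspan x hx.1)
      rintro b ⟨hb, hbx⟩
      exact Finset.mem_coe.2 (Finset.mem_filter.2 ⟨hb, hbx.trans hx.2⟩)
    have h3 := M.eRk_mono h2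
    rw [h1.eRk_eq_encard, M.eRk_closure_eq] at h3
    have h4 := h3.trans (M.eRk_le_encard _)
    rwa [encard_coe_eq_coe_finsetCard, encard_coe_eq_coe_finsetCard, Nat.cast_le] at h4
  refine sum_le_sum_of_forall_card_le v X B (hcard.antisymm ?_) key
  rcases X.eq_empty_or_nonempty with rfl | hne
  · simp
  · obtain ⟨x, hx, hxmax⟩ := X.exists_max_image v hne
    have h1 := key (v x)
    rw [Finset.filter_true_of_mem hxmax] at h1
    exact h1.trans (Finset.card_filter_le _ _)

/-! ### Gains, and cheapest bases with few elements outside `G` -/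

namespace IsSwapSequence

variable {α : Type*} {M : Matroid α} {pos : α → ℕ} {G : Set α} {X : Finset α} {e f : ℕ → α} {m : ℕ}
  {w : α → ℝ}

/-- The reduction of weight when `f i` is swapped for `e i`. -/
def gain (w : α → ℝ) (e f : ℕ → α) (i : ℕ) : ℝ := w (e i) - w (f i)

variable (h : IsSwapSequence M pos G X e f m)
  (hw : ∀ x ∈ M.E, ∀ y ∈ M.E, pos x ≤ pos y → w x ≤ w y)
include h hw

theorem gain_nonneg {i : ℕ} (hi : i < m) : 0 ≤ gain w e f i :=
  sub_nonneg.2 (hw _ (h.f_mem_ground hi) _ (h.subset_ground (h.e_mem_green hi))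
    (h.pos_f_lt_pos_e hi).le)

/-- Any set of swaps can be realized, with at least the sum of their gains. -/
theorem exists_isBase_of_subset (I : Finset ℕ) (hI : ∀ i ∈ I, i < m) :
    ∃ Y : Finset α, M.IsBase (Y : Set α) ∧ (Y : Set α) ⊆ G ∪ f '' I ∧
      ∑ x ∈ Y, w x ≤ ∑ x ∈ X, w x - ∑ i ∈ I, gain w e f i := by
  classical
  -- The largest index is inserted last, so the elements `f j` already in `Y` all have smaller
  -- index.
  induction I using Finset.induction_on_max with
  | empty => exact ⟨X, h.isBase, fun x hx => Or.inl (h.greedy.subset hx), by simp⟩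
  | insert i I hmax ih =>
    obtain ⟨Y, hY, hYsub, hYw⟩ := ih fun j hj => hI j (Finset.mem_insert_of_mem hj)
    have hi : i < m := hI i (Finset.mem_insert_self _ _)
    have hfY : f i ∉ (Y : Set α) := by
      intro hc
      rcases hYsub hc with h1 | ⟨j, hj, hji⟩
      · exact h.f_notMem i hi h1
      · have hj' := hmax j hj
        exact hj'.ne (h.f_injOn (mem_Iio.2 (hj'.trans hi)) (mem_Iio.2 hi) hji)
    have hcl : f i ∈ M.closure Y := by rw [hY.closure_eq]; exact h.f_mem_ground hi
    have hC := hY.fundCircuit_isCircuit (h.f_mem_ground hi) hfY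
    have hCsub := M.fundCircuit_subset_insert (f i) (Y : Set α)
    have hCfin : {y | y ∈ M.fundCircuit (f i) (Y : Set α) ∧ y ∈ G}.Finite :=
      (Y.finite_toSet.insert (f i)).subset fun y hy => hCsub hy.1
    -- A circuit that avoids `G` would consist of elements `f j` only, and these are independent.
    have hne : {y | y ∈ M.fundCircuit (f i) (Y : Set α) ∧ y ∈ G}.Nonempty := by
      by_contra hempty
      rw [not_nonempty_iff_eq_empty] at hempty
      refine hC.not_indep (h.f_indep.subset fun y hy => ?_)
      rcases hCsub hy with rfl | hyY
      · exact ⟨i, hi, rfl⟩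
      · rcases hYsub hyY with h1 | ⟨j, hj, rfl⟩
        · exact (eq_empty_iff_forall_notMem.1 hempty y ⟨hy, h1⟩).elim
        · exact ⟨j, (hmax j hj).trans hi, rfl⟩
    obtain ⟨y, ⟨hyC, hyG⟩, hymax⟩ := hCfin.exists_maximalFor pos _ hne
    have hyf : y ≠ f i := by rintro rfl; exact h.f_notMem i hi hyG
    have hyY : y ∈ Y := by
      rcases hCsub hyC with h1 | h1
      · exact absurd h1 hyf
      · exact h1
    -- If the last element of the circuit in `G` came before `e i`, the circuit would put `f i` into
    -- the span excluded by `f_notMem_closure`. Hence dropping `y` saves at least as much as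
    -- dropping `e i`.
    have hpos : pos (e i) ≤ pos y := by
      by_contra hlt
      refine h.f_notMem_closure hi (M.closure_subset_closure ?_
        (hC.mem_closure_sdiff_singleton_of_mem (M.mem_fundCircuit _ _)))
      rintro z ⟨hz, hzf⟩
      rcases hCsub hz with h1 | h1
      · exact absurd h1 hzf
      · rcases hYsub h1 with h2 | ⟨j, hj, rfl⟩
        · refine Or.inr ⟨h2, lt_of_le_of_lt ?_ (not_le.1 hlt)⟩
          by_contra hgt
          exact hgt (hymax ⟨hz, h2⟩ (not_le.1 hgt).le)
        · exact Or.inl ⟨j, hmax j hj, rfl⟩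
    have hbase := hY.exchange_isBase_of_indep' (Finset.mem_coe.2 hyY) hfY
      ((hY.indep.mem_fundCircuit_iff hcl hfY).1 hyC)
    have hfY' : f i ∉ Y := hfY
    refine ⟨(insert (f i) Y).erase y, ?_, ?_, ?_⟩
    · simpa using hbase
    · intro z hz
      rw [Finset.coe_erase, Finset.coe_insert] at hz
      rcases hz.1 with rfl | h1
      · exact Or.inr ⟨i, by simp, rfl⟩
      · rcases hYsub h1 with h2 | ⟨j, hj, rfl⟩
        · exact Or.inl h2
        · exact Or.inr ⟨j, by simp [Finset.mem_coe.1 hj], rfl⟩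
    · have h1 := Finset.add_sum_erase (insert (f i) Y) w (Finset.mem_insert_of_mem hyY)
      rw [Finset.sum_insert hfY'] at h1
      rw [Finset.sum_insert fun hc => lt_irrefl _ (hmax i hc), gain]
      have h2 := hw _ (h.subset_ground (h.e_mem_green hi)) _ (h.subset_ground hyG) hpos
      linarith

open Classical in
/-- The weight of a minimum weight basis when a penalty `c` is imposed on elements outside `G`. -/
theorem le_penalized_weight [M.Finite] {c : ℝ} (hc : 0 ≤ c) {Z : Finset α} (hZ : M.IsBase (Z : Set α)) :
    ∑ x ∈ X, w x - ∑ i ∈ Finset.range m, max (gain w e f i - c) 0 ≤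
      ∑ x ∈ Z, (w x + if x ∈ G then 0 else c) := by
  set v : α → ℝ := fun x => w x + if x ∈ G then 0 else c with hv
  -- The swaps that pay for the penalty.
  set J := (Finset.range m).filter fun i => c < gain w e f i with hJ
  have hJm : ∀ i ∈ J, i < m := fun i hi => Finset.mem_range.1 (Finset.mem_filter.1 hi).1
  have heJ : J.image e ⊆ X := by
    intro y hy
    obtain ⟨i, hi, rfl⟩ := Finset.mem_image.1 hy
    exact h.e_mem i (hJm i hi)
  have hinje : InjOn e (J : Set ℕ) := h.e_injOn.mono fun i hi => hJm i hi
  have hinjf : InjOn f (J : Set ℕ) := h.f_injOn.mono fun i hi => hJm i hi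
  have hfX : ∀ i < m, f i ∉ X := fun i hi hc => h.f_notMem i hi (h.greedy.subset hc)
  have hdisj : Disjoint (X \ J.image e) (J.image f) := by
    rw [Finset.disjoint_left]
    intro y hy hy'
    obtain ⟨i, hi, rfl⟩ := Finset.mem_image.1 hy'
    exact hfX i (hJm i hi) (Finset.mem_sdiff.1 hy).1
  set B := (X \ J.image e) ∪ J.image f with hB
  have hBground : ∀ b ∈ B, b ∈ M.E := by
    intro b hb
    rcases Finset.mem_union.1 hb with h1 | h1
    · exact h.isBase.subset_ground (Finset.mem_sdiff.1 h1).1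
    · obtain ⟨i, hi, rfl⟩ := Finset.mem_image.1 h1
      exact h.f_mem_ground (hJm i hi)
  have hvf : ∀ i < m, v (f i) = w (f i) + c := fun i hi => by simp [hv, h.f_notMem i hi]
  have hvG : ∀ x ∈ G, v x = w x := fun x hx => by simp [hv, hx]
  have hwv : ∀ x, w x ≤ v x := fun x => by
    simp only [hv]; split_ifs <;> linarith
  -- Independence of `B` is not needed: that it is no larger than a basis, together with the
  -- spanning property below, suffices.
  have hcardB : B.card ≤ Z.card := by
    have h1 : X.card = Z.card := by
      have := h.isBase.encard_eq_encard_of_isBase hZ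
      rwa [encard_coe_eq_coe_finsetCard, encard_coe_eq_coe_finsetCard, Nat.cast_inj] at this
    rw [hB, Finset.card_union_of_disjoint hdisj, Finset.card_sdiff_of_subset heJ,
      Finset.card_image_of_injOn hinje, Finset.card_image_of_injOn hinjf, ← h1]
    have := Finset.card_le_card heJ
    rw [Finset.card_image_of_injOn hinje] at this
    omega
  have hsum : ∑ x ∈ B, v x =
      ∑ x ∈ X, w x - ∑ i ∈ Finset.range m, max (gain w e f i - c) 0 := by
    have h1 : ∑ x ∈ X, v x = ∑ x ∈ X, w x :=
      Finset.sum_congr rfl fun x hx => hvG x (h.greedy.subset hx)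
    have h2 := Finset.sum_sdiff (f := v) heJ
    have h3 : ∑ i ∈ Finset.range m, max (gain w e f i - c) 0 = ∑ i ∈ J, (gain w e f i - c) := by
      rw [hJ, Finset.sum_filter]
      refine Finset.sum_congr rfl fun i _ => ?_
      split_ifs with hlt
      · exact max_eq_left (by linarith)
      · exact max_eq_right (by linarith)
    rw [hB, Finset.sum_union hdisj, h3, Finset.sum_image hinjf]
    rw [Finset.sum_image hinje, h1] at h2
    have h4 : ∑ i ∈ J, (gain w e f i - c) = ∑ i ∈ J, v (e i) - ∑ i ∈ J, v (f i) := by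
      rw [← Finset.sum_sub_distrib]
      refine Finset.sum_congr rfl fun i hi => ?_
      rw [hvf i (hJm i hi), hvG _ (h.e_mem_green (hJm i hi)), gain]
      ring
    linarith
  rw [← hsum]
  refine sum_le_sum_of_mem_closure v hZ.indep hcardB fun x hx => ?_

  -- Order the elements by penalized weight, ties in favour of `G`, and remaining ties by position.
  -- An element outside `B` is spanned by strictly earlier elements. The four cases are: an `e i`
  -- that is swapped out, an element of `G` outside `X`, an `f i` that is not swapped in, and an
  -- element outside both `G` and the list `f`.
  have step : ∀ x ∈ M.E, x ∉ B → x ∈ M.closure {y | y ∈ M.E ∧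
      (v y < v x ∨ v y = v x ∧ (y ∈ G ∧ x ∉ G ∨ (y ∈ G ↔ x ∈ G) ∧ pos y < pos x))} := by
    intro x hxE hxB
    have hwX : ∀ y ∈ X, ∀ z ∈ M.E, pos y ≤ pos z → v y ≤ w z := fun y hy z hz hyz => by
      rw [hvG y (h.greedy.subset hy)]
      exact hw _ (h.isBase.subset_ground hy) _ hz hyz
    by_cases hxG : x ∈ G
    · by_cases hxX : x ∈ X
      · have hxJ : x ∈ J.image e := by
          by_contra hne
          exact hxB (Finset.mem_union_left _ (Finset.mem_sdiff.2 ⟨hxX, hne⟩))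
        obtain ⟨i, hi, rfl⟩ := Finset.mem_image.1 hxJ
        have him := hJm i hi
        have hgain : w (f i) + c < w (e i) := by
          have := (Finset.mem_filter.1 hi).2
          rw [gain] at this
          linarith
        -- The elements `f j` with `j ≤ i` are no heavier than `f i`, which even with the penalty is
        -- strictly cheaper than `e i`.
        refine M.closure_subset_closure ?_ (h.e_mem_closure him)
        rintro y (⟨j, hj, rfl⟩ | ⟨h1, -, h2⟩)
        · have hjm : j < m := lt_of_le_of_lt hj him
          refine ⟨h.f_mem_ground hjm, Or.inl ?_⟩
          rw [hvf j hjm, hvG _ hxG]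
          have : w (f j) ≤ w (f i) := by
            rcases (mem_Iic.1 hj).eq_or_lt with rfl | hlt
            · exact le_rfl
            · exact hw _ (h.f_mem_ground hjm) _ (h.f_mem_ground him) (h.f_mono j i hlt him).le
          linarith
        · refine ⟨h.isBase.subset_ground h1, ?_⟩
          have h3 := hwX y h1 _ hxE h2.le
          rw [← hvG _ hxG] at h3
          exact h3.lt_or_eq.imp_right fun h4 =>
            ⟨h4, Or.inr ⟨iff_of_true (h.greedy.subset h1) hxG, h2⟩⟩
      · refine M.closure_subset_closure ?_ (h.greedy.span x hxG)
        rintro y ⟨h1, h2⟩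
        have hyE := h.isBase.subset_ground h1
        have h2' : pos y < pos x := lt_of_le_of_ne h2 fun hpos => by
          rw [h.injOn_pos hyE hxE hpos] at h1
          exact hxX h1
        refine ⟨hyE, ?_⟩
        have h3 := hwX y h1 _ hxE h2
        rw [← hvG _ hxG] at h3
        exact h3.lt_or_eq.imp_right fun h4 =>
          ⟨h4, Or.inr ⟨iff_of_true (h.greedy.subset h1) hxG, h2'⟩⟩
    · have hvx : v x = w x + c := by simp [hv, hxG]
      by_cases hxf : x ∈ f '' Iio m
      · obtain ⟨i, him, rfl⟩ := hxf
        -- Here the gain is at most `c`. Equality is possible, which is why ties must favour `G`.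
        have hgain : w (e i) ≤ v (f i) := by
          by_contra hlt
          refine hxB (Finset.mem_union_right _ (Finset.mem_image_of_mem _ (Finset.mem_filter.2
            ⟨Finset.mem_range.2 him, ?_⟩)))
          rw [gain]
          linarith
        refine M.closure_subset_closure ?_ (h.f_mem_closure him)
        rintro y (⟨j, hj, rfl⟩ | ⟨h1, h2⟩)
        · have hjm : j < m := lt_trans hj him
          refine ⟨h.f_mem_ground hjm, ?_⟩
          have hpos := h.f_mono j i hj him
          have h3 := hw _ (h.f_mem_ground hjm) _ hxE hpos.le
          have h4 : v (f j) ≤ v (f i) := by rw [hvf j hjm, hvx]; linarith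
          exact h4.lt_or_eq.imp_right fun h5 =>
            ⟨h5, Or.inr ⟨iff_of_false (h.f_notMem j hjm) hxG, hpos⟩⟩
        · refine ⟨h.isBase.subset_ground h1, ?_⟩
          have h3 := (hwX y h1 _ (h.isBase.subset_ground (h.e_mem i him)) h2).trans hgain
          exact h3.lt_or_eq.imp_right fun h4 => ⟨h4, Or.inl ⟨h.greedy.subset h1, hxG⟩⟩
      · refine M.closure_subset_closure ?_ (h.span x hxE hxG hxf)
        rintro y ⟨h1 | ⟨j, hjm, rfl⟩, h2⟩
        · have hyE := h.subset_ground h1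
          refine ⟨hyE, ?_⟩
          have h3 := hw _ hyE _ hxE h2.le
          rw [← hvG y h1] at h3
          exact (h3.trans (hwv x)).lt_or_eq.imp_right fun h4 => ⟨h4, Or.inl ⟨h1, hxG⟩⟩
        · have hyE := h.f_mem_ground hjm
          refine ⟨hyE, ?_⟩
          have h3 := hw _ hyE _ hxE h2.le
          have h4 : v (f j) ≤ v x := by rw [hvf j hjm, hvx]; linarith
          exact h4.lt_or_eq.imp_right fun h5 =>
            ⟨h5, Or.inr ⟨iff_of_false (h.f_notMem j hjm) hxG, h2⟩⟩
  -- A first counterexample in the order of `step` would be spanned by earlier elements, for which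
  -- the claim holds.
  have hspan : ∀ x ∈ M.E, x ∈ M.closure {b | b ∈ B ∧ v b ≤ v x} := by
    by_contra! hbad
    obtain ⟨x, ⟨hxE, hx⟩, hmin⟩ := (M.ground_finite.subset
      (show {x | x ∈ M.E ∧ x ∉ M.closure {b | b ∈ B ∧ v b ≤ v x}} ⊆ M.E from
        fun x hx => hx.1)).exists_minimalFor
      (fun x => toLex (v x, toLex ((if x ∈ G then 0 else 1 : ℕ), pos x))) _ hbad
    have hsub : {b | b ∈ B ∧ v b ≤ v x} ⊆ M.E := fun b hb => hBground b hb.1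
    have hxB : x ∉ B := fun hxB =>
      hx (M.mem_closure_of_mem (X := {b | b ∈ B ∧ v b ≤ v x}) ⟨hxB, le_rfl⟩ hsub)
    refine hx (M.closure_subset_closure_of_subset_closure (fun y hyx => ?_) (step x hxE hxB))
    obtain ⟨hyE, hy⟩ := hyx
    have hvyx : v y ≤ v x := by
      rcases hy with h1 | ⟨h1, -⟩
      · exact h1.le
      · exact h1.le
    by_contra hcon
    have hybad : y ∉ M.closure {b | b ∈ B ∧ v b ≤ v y} := fun hc =>
      hcon (M.closure_subset_closure (Y := {b | b ∈ B ∧ v b ≤ v x})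
        (fun b hb => ⟨hb.1, hb.2.trans hvyx⟩) hc)
    have hlt : toLex (v y, toLex ((if y ∈ G then 0 else 1 : ℕ), pos y)) <
        toLex (v x, toLex ((if x ∈ G then 0 else 1 : ℕ), pos x)) := by
      rw [Prod.Lex.toLex_lt_toLex]
      refine hy.imp_right fun h1 => ⟨h1.1, ?_⟩
      simp only [Prod.Lex.toLex_lt_toLex]
      rcases h1.2 with ⟨h2, h3⟩ | ⟨h2, h3⟩
      · left; simp [h2, h3]
      · right; simp [h2, h3]
    exact not_le.2 hlt (hmin ⟨hyE, hybad⟩ hlt.le)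
  exact hspan x (hZ.subset_ground hx)

open Classical in
/-- Swapping in the elements with the largest gains is optimal among the bases with a bounded
number of elements outside `G`. -/
theorem exists_isBase_sum_le [M.Finite] {σ : ℕ → ℕ} (hσm : ∀ j < m, σ j < m) (hσ : InjOn σ (Iio m))
    (hanti : ∀ i j, i ≤ j → j < m → gain w e f (σ j) ≤ gain w e f (σ i)) (k : ℕ)
    {Z : Finset α} (hZ : M.IsBase (Z : Set α)) (hk : (Z.filter fun x => x ∉ G).card ≤ k) :
    ∃ Y : Finset α, M.IsBase (Y : Set α) ∧
      (Y : Set α) ⊆ G ∪ {x | ∃ j < m, j < k ∧ x = f (σ j)} ∧ ∑ x ∈ Y, w x ≤ ∑ x ∈ Z, w x := by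
  have hpen : ∀ c, ∑ x ∈ Z, (w x + if x ∈ G then 0 else c) =
      ∑ x ∈ Z, w x + (Z.filter fun x => x ∉ G).card * c := by
    intro c
    rw [Finset.sum_add_distrib]
    congr 1
    rw [← nsmul_eq_mul, ← Finset.sum_const, Finset.sum_filter]
    exact Finset.sum_congr rfl fun x _ => by split_ifs <;> simp_all
  have himage : (Finset.range m).image σ = Finset.range m := by
    refine Finset.eq_of_subset_of_card_le (fun i hi => ?_) ?_
    · obtain ⟨j, hj, rfl⟩ := Finset.mem_image.1 hi
      exact Finset.mem_range.2 (hσm j (Finset.mem_range.1 hj))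
    · rw [Finset.card_image_of_injOn (by simpa using hσ)]
  have hreindex : ∀ φ : ℕ → ℝ, ∑ i ∈ Finset.range m, φ i = ∑ j ∈ Finset.range m, φ (σ j) := by
    intro φ
    conv_lhs => rw [← himage]
    exact Finset.sum_image (by simpa using hσ)
  obtain ⟨Y, hY, hYsub, hYw⟩ := h.exists_isBase_of_subset hw ((Finset.range (min k m)).image σ)
    (by
      intro i hi
      obtain ⟨j, hj, rfl⟩ := Finset.mem_image.1 hi
      exact hσm j (lt_of_lt_of_le (Finset.mem_range.1 hj) (min_le_right _ _)))
  rw [Finset.sum_image (hσ.mono fun j hj => by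
    have := Finset.mem_range.1 (Finset.mem_coe.1 hj)
    exact mem_Iio.2 (by omega))] at hYw
  refine ⟨Y, hY, fun x hx => ?_, hYw.trans ?_⟩
  · rcases hYsub hx with h1 | ⟨i, hi, rfl⟩
    · exact Or.inl h1
    · obtain ⟨j, hj, rfl⟩ := Finset.mem_image.1 (Finset.mem_coe.1 hi)
      have := Finset.mem_range.1 hj
      exact Or.inr ⟨j, by omega, by omega, rfl⟩
  -- The multiplier is `0` if all swaps are allowed. Otherwise it is the `k+1`-st largest gain, for
  -- which exactly the terms beyond the first `k` vanish, while the first `k` terms lose `k * c` in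
  -- total, at least the penalty paid by `Z`.
  · rcases le_or_gt m k with hmk | hkm
    · have h1 := h.le_penalized_weight hw le_rfl hZ
      rw [hpen, mul_zero, add_zero, hreindex] at h1
      rw [min_eq_right hmk]
      refine le_trans (le_of_eq ?_) h1
      congr 1
      refine Finset.sum_congr rfl fun j hj => ?_
      rw [sub_zero, max_eq_left (h.gain_nonneg hw (hσm j (Finset.mem_range.1 hj)))]
    · have h1 := h.le_penalized_weight hw (h.gain_nonneg hw (hσm k hkm)) hZ
      rw [hpen, hreindex] at h1
      set c := gain w e f (σ k)
      have hc : 0 ≤ c := h.gain_nonneg hw (hσm k hkm)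
      have h2 : ∑ j ∈ Finset.range m, max (gain w e f (σ j) - c) 0 =
          ∑ j ∈ Finset.range k, (gain w e f (σ j) - c) := by
        rw [← Finset.sum_subset (Finset.range_mono hkm.le)]
        · refine Finset.sum_congr rfl fun j hj => max_eq_left ?_
          have := hanti j k (Finset.mem_range.1 hj).le hkm
          linarith
        · intro j hj hj'
          refine max_eq_right ?_
          have := hanti k j (by simpa using hj') (Finset.mem_range.1 hj)
          linarith
      rw [h2, Finset.sum_sub_distrib, Finset.sum_const, Finset.card_range, nsmul_eq_mul] at h1
      rw [min_eq_left hkm.le]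
      have h3 : ((Z.filter fun x => x ∉ G).card : ℝ) * c ≤ k * c :=
        mul_le_mul_of_nonneg_right (by exact_mod_cast hk) hc
      linarith

end IsSwapSequence

/-! ### Total correctness with time bounds -/

/-- Started in `s`, the program `p` halts within `T` steps in a configuration that satisfies `Q`. -/
def Runs {n : ℕ} (M : Matroid (Fin n)) (p : Prog) (s : State) (T : ℕ) (Q : State → Prop) : Prop :=
  ∃ t s', Exec M p s t s' ∧ t ≤ T ∧ Q s'

/-- The sequence of a list of instructions. -/
def Prog.block : List Instr → Prog
  | [] => .skip
  | c :: l => .seq (.instr c) (Prog.block l)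

namespace Runs

variable {n : ℕ} {M : Matroid (Fin n)} {p q : Prog} {b : Test} {s : State} {T U : ℕ}
  {P Q : State → Prop}

theorem mono (h : Runs M p s T P) (hT : T ≤ U) (hQ : ∀ s', P s' → Q s') : Runs M p s U Q := by
  obtain ⟨t, s', h1, h2, h3⟩ := h
  exact ⟨t, s', h1, h2.trans hT, hQ s' h3⟩

theorem skip (h : Q s) : Runs M .skip s T Q := ⟨0, s, .skip s, Nat.zero_le _, h⟩

theorem instr {c : Instr} (h : Q (c.apply s)) (hT : 1 ≤ T) : Runs M (.instr c) s T Q :=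
  ⟨1, _, .instr c s, hT, h⟩

theorem seq (h : Runs M p s T P) (h' : ∀ s', P s' → Runs M q s' U Q) :
    Runs M (.seq p q) s (T + U) Q := by
  obtain ⟨t, s', h1, h2, h3⟩ := h
  obtain ⟨u, s'', h4, h5, h6⟩ := h' s' h3
  exact ⟨t + u, s'', .seq h1 h4, by omega, h6⟩

theorem block {l : List Instr} (h : Q (l.foldl Instr.apply s)) (hT : l.length ≤ T) :
    Runs M (Prog.block l) s T Q := by
  induction l generalizing s T with
  | nil => exact skip h
  | cons c l ih =>
    simp only [List.length_cons] at hT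
    exact ((instr (Q := fun s' => s' = c.apply s) rfl le_rfl).seq fun s' hs' =>
      hs' ▸ ih (T := l.length) h le_rfl).mono (by omega) fun _ => id

theorem ite (h : b.Holds M s → Runs M p s T Q) (h' : ¬ b.Holds M s → Runs M q s T Q) :
    Runs M (.ite b p q) s (T + 1) Q := by
  by_cases hb : b.Holds M s
  · obtain ⟨t, s', h1, h2, h3⟩ := h hb
    exact ⟨t + 1, s', .ite_true hb h1, by omega, h3⟩
  · obtain ⟨t, s', h1, h2, h3⟩ := h' hb
    exact ⟨t + 1, s', .ite_false hb h1, by omega, h3⟩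

/-- A loop that is run through exactly `N` times. -/
theorem loop {Inv : ℕ → State → Prop} {N c : ℕ}
    (step : ∀ k < N, ∀ s, Inv k s → b.Holds M s ∧ Runs M p s c (Inv (k + 1)))
    (hexit : ∀ s, Inv N s → ¬ b.Holds M s) (h : Inv 0 s) :
    Runs M (.loop b p) s (N * (c + 1) + 1) (Inv N) := by
  have key : ∀ j k s, k + j = N → Inv k s →
      Runs M (.loop b p) s (j * (c + 1) + 1) (Inv N) := by
    intro j
    induction j with
    | zero =>
      intro k s hk hs
      have hk' : k = N := hk
      subst hk'
      exact ⟨1, s, .loop_false (hexit s hs), by omega, hs⟩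
    | succ j ih =>
      intro k s hk hs
      obtain ⟨hb, t, s', h1, h2, h3⟩ := step k (by omega) s hs
      obtain ⟨u, s'', h4, h5, h6⟩ := ih (k + 1) s' (by omega) h3
      exact ⟨t + u + 1, s'', .loop_true hb h1 h4, by rw [Nat.succ_mul]; omega, h6⟩
  exact key N 0 s (by omega) h

end Runs

/-- The listed integer registers and arrays agree. -/
def Agree (rs as : List ℕ) (s s' : State) : Prop :=
  (∀ i ∈ rs, s'.reg i = s.reg i) ∧ ∀ a ∈ as, s'.arr a = s.arr a

theorem Agree.refl (rs as : List ℕ) (s : State) : Agree rs as s s :=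
  ⟨fun _ _ => rfl, fun _ _ => rfl⟩

theorem Agree.trans {rs as : List ℕ} {s s' s'' : State} (h : Agree rs as s s')
    (h' : Agree rs as s' s'') : Agree rs as s s'' :=
  ⟨fun i hi => (h'.1 i hi).trans (h.1 i hi), fun a ha => (h'.2 a ha).trans (h.2 a ha)⟩

theorem Agree.reg {rs as : List ℕ} {s s' : State} (h : Agree rs as s s') (i : ℕ)
    (hi : i ∈ rs := by decide) : s'.reg i = s.reg i := h.1 i hi

theorem Agree.arr {rs as : List ℕ} {s s' : State} (h : Agree rs as s s') (a : ℕ)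
    (ha : a ∈ as := by decide) : s'.arr a = s.arr a := h.2 a ha

/-! ### Merging -/

/-- Every aligned block of length `h` is sorted. -/
def SortedBlocks (key : ℕ → ℝ) (a : ℕ → ℕ) (N h : ℕ) : Prop :=
  ∀ c i j, c * h ≤ i → i ≤ j → j < c * h + h → j < N → key (a i) ≤ key (a j)

/-- The state of a pass that merges the blocks of length `h` of `a` pairwise into `d`: the first `k`
entries have been written, and `[p, pe)` and `[q, qe)` remain of the two current blocks. -/
structure MergeInv (key : ℕ → ℝ) (a d : ℕ → ℕ) (N h k p pe q qe : ℕ) : Prop where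
  p_le : p ≤ pe
  pe_le : pe ≤ q
  q_le : q ≤ qe
  qe_le : qe ≤ N
  count : k + pe = p + q
  boundary : p = pe → q = qe → k = N ∨ ∃ c, k = c * (2 * h)
  current : p < pe ∨ q < qe → ∃ c, c * (2 * h) ≤ k ∧ qe = min (c * (2 * h) + 2 * h) N ∧
    ∀ i, c * (2 * h) ≤ i → i < k → ∀ j, (p ≤ j ∧ j < pe ∨ q ≤ j ∧ j < qe) → key (d i) ≤ key (a j)
  sorted_left : ∀ i j, p ≤ i → i ≤ j → j < pe → key (a i) ≤ key (a j)
  sorted_right : ∀ i j, q ≤ i → i ≤ j → j < qe → key (a i) ≤ key (a j)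
  sorted : ∀ c i j, c * (2 * h) ≤ i → i ≤ j → j < k → j < c * (2 * h) + 2 * h →
    key (d i) ≤ key (d j)
  exhausts : ∀ j, (j < p ∨ pe ≤ j ∧ j < q) → ∃ i < k, d i = a j

namespace MergeInv

variable {key : ℕ → ℝ} {a d : ℕ → ℕ} {N h k p pe q qe : ℕ}

theorem init (key : ℕ → ℝ) (a d : ℕ → ℕ) (N h : ℕ) : MergeInv key a d N h 0 0 0 0 0 where
  p_le := le_rfl
  pe_le := le_rfl
  q_le := le_rfl
  qe_le := Nat.zero_le _
  count := rfl
  boundary _ _ := Or.inr ⟨0, by simp⟩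
  current hc := by omega
  sorted_left i j _ _ hj := by omega
  sorted_right i j _ _ hj := by omega
  sorted c i j _ _ hj := by omega
  exhausts j hj := by omega

/-- With both blocks used up, `q = k` is a multiple of `2 * h`, so the next two blocks start there.
The truncations at `N` allow for a short or missing last block. -/
theorem reset (hI : MergeInv key a d N h k p pe q qe) (ha : SortedBlocks key a N h) (hh : 0 < h)
    (hk : k < N) (hp : p = pe) (hq : q = qe) :
    MergeInv key a d N h k q (min (q + h) N) (min (q + h) N) (min (min (q + h) N + h) N) := by
  have hkq : k = q := by have := hI.count; omega
  obtain ⟨c, hc⟩ : ∃ c, k = c * (2 * h) := (hI.boundary hp hq).resolve_left (by omega)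
  have h1 : (2 * c) * h = c * (2 * h) := by ring
  have h2 : (2 * c + 1) * h = c * (2 * h) + h := by ring
  refine ⟨by omega, le_rfl, by omega, by omega, by omega, fun _ _ => by omega,
    fun _ => ⟨c, by omega, by omega, fun i hi hi' => by omega⟩, ?_, ?_, hI.sorted, ?_⟩
  · intro i j hi hij hj
    exact ha (2 * c) i j (by omega) hij (by omega) (by omega)
  · intro i j hi hij hj
    exact ha (2 * c + 1) i j (by omega) hij (by omega) (by omega)
  · intro j hj
    exact hI.exhausts j (by omega)

theorem block_unique {c c' b k : ℕ} (h1 : c * b ≤ k) (h2 : k < c * b + b) (h3 : c' * b ≤ k)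
    (h4 : k < c' * b + b) : c = c' := by
  have key : ∀ x y : ℕ, x < y → x * b + b ≤ y * b := fun x y hxy => by
    rw [← Nat.succ_mul]
    exact Nat.mul_le_mul_right _ hxy
  rcases lt_trichotomy c c' with hlt | heq | hgt
  · have := key _ _ hlt; omega
  · exact heq
  · have := key _ _ hgt; omega

/-- Treats both sides alike, with `x` the position of the entry that is moved. What the current pair
of blocks has already output is bounded by its key through `current`, and its key bounds what
remains through `hmin`. -/
theorem append {x p' q' : ℕ} (hI : MergeInv key a d N h k p pe q qe)
    (hx : p ≤ x ∧ x < pe ∨ q ≤ x ∧ x < qe)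
    (hmin : ∀ j, (p ≤ j ∧ j < pe ∨ q ≤ j ∧ j < qe) → key (a x) ≤ key (a j))
    (hp : p ≤ p') (hp' : p' ≤ pe) (hq : q ≤ q') (hq' : q' ≤ qe) (hcount : k + 1 + pe = p' + q')
    (hnew : ∀ j, (p ≤ j ∧ j < p' ∨ q ≤ j ∧ j < q') → j = x) :
    MergeInv key a (Function.update d k (a x)) N h (k + 1) p' pe q' qe := by
  obtain ⟨c, hck, hqe, hdom⟩ := hI.current (by omega)
  have := hI.count
  have := hI.pe_le
  have := hI.qe_le
  refine ⟨hp', by omega, hq', hI.qe_le, hcount, ?_, ?_, ?_, ?_, ?_, ?_⟩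
  · intro h1 h2
    rcases le_total (c * (2 * h) + 2 * h) N with hle | hle
    · exact Or.inr ⟨c + 1, by rw [Nat.succ_mul]; omega⟩
    · exact Or.inl (by omega)
  · refine fun _ => ⟨c, by omega, hqe, fun i hi hik j hj => ?_⟩
    rcases Nat.lt_succ_iff_lt_or_eq.1 hik with hlt | rfl
    · rw [Function.update_of_ne hlt.ne]
      exact hdom i hi hlt j (by omega)
    · rw [Function.update_self]
      exact hmin j (by omega)
  · exact fun i j hi => hI.sorted_left i j (by omega)
  · exact fun i j hi => hI.sorted_right i j (by omega)
  · intro c' i j hi hij hj hjc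
    rcases Nat.lt_succ_iff_lt_or_eq.1 hj with hlt | rfl
    · rw [Function.update_of_ne hlt.ne, Function.update_of_ne (by omega)]
      exact hI.sorted c' i j hi hij hlt hjc
    · rw [Function.update_self]
      rcases hij.eq_or_lt with rfl | hlt
      · rw [Function.update_self]
      · rw [Function.update_of_ne hlt.ne]
        have hcc : c' = c := block_unique (by omega) hjc hck (by omega)
        subst hcc
        exact hdom i hi hlt x hx
  · intro j hj
    by_cases hjx : j = x
    · exact ⟨k, by omega, by rw [Function.update_self, hjx]⟩
    · have hold : j < p ∨ pe ≤ j ∧ j < q := by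
        by_contra hc
        exact hjx (hnew j (by omega))
      obtain ⟨i, hi, hij⟩ := hI.exhausts j hold
      exact ⟨i, by omega, by rwa [Function.update_of_ne hi.ne]⟩

theorem take_left (hI : MergeInv key a d N h k p pe q qe) (hp : p < pe)
    (hle : q < qe → key (a p) ≤ key (a q)) :
    MergeInv key a (Function.update d k (a p)) N h (k + 1) (p + 1) pe q qe := by
  have := hI.count
  refine hI.append (Or.inl ⟨le_rfl, hp⟩) ?_ (by omega) hp le_rfl hI.q_le (by omega)
    (fun j hj => by omega)
  rintro j (⟨h1, h2⟩ | ⟨h1, h2⟩)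
  · exact hI.sorted_left p j le_rfl h1 h2
  · exact (hle (by omega)).trans (hI.sorted_right q j le_rfl h1 h2)

theorem take_right (hI : MergeInv key a d N h k p pe q qe) (hq : q < qe)
    (hle : p < pe → key (a q) ≤ key (a p)) :
    MergeInv key a (Function.update d k (a q)) N h (k + 1) p pe (q + 1) qe := by
  have := hI.count
  refine hI.append (Or.inr ⟨le_rfl, hq⟩) ?_ le_rfl hI.p_le (by omega) hq (by omega)
    (fun j hj => by omega)
  rintro j (⟨h1, h2⟩ | ⟨h1, h2⟩)
  · exact (hle (by omega)).trans (hI.sorted_left p j le_rfl h1 h2)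
  · exact hI.sorted_right q j le_rfl h1 h2

theorem sortedBlocks (hI : MergeInv key a d N h N p pe q qe) : SortedBlocks key d N (2 * h) :=
  fun c i j hi hij hj hjN => hI.sorted c i j hi hij hjN hj

theorem exists_eq (hI : MergeInv key a d N h N p pe q qe) {j : ℕ} (hj : j < N) :
    ∃ i < N, d i = a j := by
  have := hI.count
  have := hI.p_le
  have := hI.q_le
  have := hI.qe_le
  exact hI.exhausts j (by omega)

end MergeInv

/-- `a 0, …, a (N - 1)` is an arrangement of `0, …, N - 1` in order of increasing keys. -/
structure IsSorting (key : ℕ → ℝ) (N : ℕ) (a : ℕ → ℕ) : Prop where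
  lt : ∀ j < N, a j < N
  injOn : InjOn a (Iio N)
  surj : ∀ x < N, ∃ j < N, a j = x
  mono : ∀ i j, i ≤ j → j < N → key (a i) ≤ key (a j)

/-- A single block covers everything. As `N` indices hit all `N` values below `N`, counting shows
that no other value occurs and none occurs twice. -/
theorem SortedBlocks.isSorting {key : ℕ → ℝ} {a : ℕ → ℕ} {N h : ℕ} (ha : SortedBlocks key a N h)
    (hN : N ≤ h) (hsurj : ∀ x < N, ∃ j < N, a j = x) : IsSorting key N a := by
  have hsub : Finset.range N ⊆ (Finset.range N).image a := fun x hx => by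
    obtain ⟨j, hj, rfl⟩ := hsurj x (Finset.mem_range.1 hx)
    exact Finset.mem_image_of_mem _ (Finset.mem_range.2 hj)
  have heq := Finset.eq_of_subset_of_card_le hsub Finset.card_image_le
  refine ⟨fun j hj => ?_, ?_, hsurj, fun i j hij hj => ha 0 i j (by omega) hij (by omega) hj⟩
  · have := Finset.mem_image_of_mem a (Finset.mem_range.2 hj)
    rw [← heq] at this
    exact Finset.mem_range.1 this
  · have : InjOn a (Finset.range N : Set ℕ) := Finset.injOn_of_card_image_eq (by rw [← heq])
    simpa using this

/-! ### Merge sort -/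

section MergeSort

/-- Registers that the sorting program leaves alone. -/
abbrev sortRegs : List ℕ := [0, 1, 2, 3, 12, 13, 14]

/-- Arrays that the sorting program leaves alone. -/
abbrev sortArrs : List ℕ := [0, 1, 3, 4, 5, 6]

/-- If both current blocks are used up, turn to the next two. -/
def mergeReset : Prog :=
  .ite (.eq 6 7) (.ite (.eq 8 9)
    (.seq (Prog.block [.copy 6 8, .add 7 8 4])
      (.seq (.ite (.lt 3 7) (.instr (.copy 7 3)) .skip)
        (.seq (Prog.block [.copy 8 7, .add 9 8 4])
          (.ite (.lt 3 9) (.instr (.copy 9 3)) .skip)))) .skip) .skip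

/-- Move the next entry of the left block. -/
def mergeLeft : Prog := Prog.block [.load 10 2 6, .store 7 5 10, .add 6 6 1, .add 5 5 1]

/-- Move the next entry of the right block. -/
def mergeRight : Prog := Prog.block [.load 10 2 8, .store 7 5 10, .add 8 8 1, .add 5 5 1]

/-- Move the smaller one of the next entries of the two blocks. -/
def mergeChoose : Prog :=
  .ite (.lt 6 7)
    (.ite (.lt 8 9)
      (.seq (Prog.block [.load 10 2 6, .load 11 2 8, .rload 0 1 10, .rload 1 1 11])
        (.ite (.rlt 1 0) mergeRight mergeLeft))
      mergeLeft)
    mergeRight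

/-- One pass of merge sort. -/
def mergePass : Prog :=
  .seq (Prog.block [.copy 5 2, .copy 6 2, .copy 7 2, .copy 8 2, .copy 9 2])
    (.seq (.loop (.lt 5 3) (.seq mergeReset mergeChoose))
      (.seq (.instr (.copy 5 2))
        (.seq (.loop (.lt 5 3) (Prog.block [.load 10 7 5, .store 2 5 10, .add 5 5 1]))
          (.instr (.add 4 4 4)))))

/-- Sort the numbers below register `3` by their keys in real array `1`, into array `2`. -/
def mergeSort : Prog :=
  .seq (.instr (.copy 5 2))
    (.seq (.loop (.lt 5 3) (Prog.block [.store 2 5 5, .add 5 5 1]))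
      (.seq (.instr (.copy 4 1)) (.loop (.lt 4 3) mergePass)))

/-- The invariant of a merging pass. -/
structure PassInv (s₀ : State) (h k : ℕ) (s : State) : Prop where
  agree : Agree sortRegs (2 :: sortArrs) s₀ s
  rarr : s.rarr = s₀.rarr
  width : s.reg 4 = h
  counter : s.reg 5 = k
  merge : MergeInv (s₀.rarr 1) (s₀.arr 2) (s.arr 7) (s₀.reg 3) h k (s.reg 6) (s.reg 7) (s.reg 8)
    (s.reg 9)

variable {n : ℕ} {M : Matroid (Fin n)} {s₀ : State} {h k : ℕ}

theorem runs_mergeReset (hh : 0 < h) (ha : SortedBlocks (s₀.rarr 1) (s₀.arr 2) (s₀.reg 3) h)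
    (hk : k < s₀.reg 3) {s : State} (hs : PassInv s₀ h k s) :
    Runs M mergeReset s 10 fun s' =>
      PassInv s₀ h k s' ∧ (s'.reg 6 < s'.reg 7 ∨ s'.reg 8 < s'.reg 9) := by
  have h3 : s.reg 3 = s₀.reg 3 := hs.agree.reg 3
  have hI := hs.merge
  refine Runs.ite (T := 9) (fun h67 => Runs.ite (T := 8) (fun h89 => ?_) fun h89 => ?_) fun h67 => ?_
  · change s.reg 6 = s.reg 7 at h67
    change s.reg 8 = s.reg 9 at h89
    have hnew := hI.reset ha hh hk h67 h89
    have hkq : k = s.reg 8 := by have := hI.count; omega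
    refine (Runs.block (T := 2) (Q := fun s' => Agree sortRegs (2 :: 7 :: sortArrs) s s' ∧
      s'.rarr = s.rarr ∧ s'.reg 4 = h ∧ s'.reg 5 = k ∧ s'.reg 6 = s.reg 8 ∧
      s'.reg 7 = s.reg 8 + h) ?_ le_rfl).seq (U := 2 + (2 + 2)) ?_
    · simp [Agree, Instr.apply, hs.width, hs.counter]
    rintro s1 ⟨a1, a2, a3, a4, a5, a6⟩
    refine (Runs.ite (T := 1) (Q := fun s' => Agree sortRegs (2 :: 7 :: sortArrs) s s' ∧
      s'.rarr = s.rarr ∧ s'.reg 4 = h ∧ s'.reg 5 = k ∧ s'.reg 6 = s.reg 8 ∧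
      s'.reg 7 = min (s.reg 8 + h) (s₀.reg 3)) (fun hlt => ?_) fun hlt => ?_).seq ?_
    · change s1.reg 3 < s1.reg 7 at hlt
      rw [a1.reg 3, h3, a6] at hlt
      refine Runs.instr ⟨a1.trans (by simp [Agree, Instr.apply]), ?_⟩ le_rfl
      simp [Instr.apply, a2, a3, a4, a5, a1.reg 3, h3, hlt.le]
    · change ¬ s1.reg 3 < s1.reg 7 at hlt
      rw [a1.reg 3, h3, a6, not_lt] at hlt
      exact Runs.skip ⟨a1, a2, a3, a4, a5, by rw [a6, min_eq_left hlt]⟩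
    rintro s2 ⟨b1, b2, b3, b4, b5, b6⟩
    refine (Runs.block (T := 2) (Q := fun s' => Agree sortRegs (2 :: 7 :: sortArrs) s s' ∧
      s'.rarr = s.rarr ∧ s'.reg 4 = h ∧ s'.reg 5 = k ∧ s'.reg 6 = s.reg 8 ∧
      s'.reg 7 = min (s.reg 8 + h) (s₀.reg 3) ∧ s'.reg 8 = min (s.reg 8 + h) (s₀.reg 3) ∧
      s'.reg 9 = min (s.reg 8 + h) (s₀.reg 3) + h) ?_ le_rfl).seq (U := 2) ?_
    · refine ⟨b1.trans (by simp [Agree, Instr.apply]), ?_⟩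
      simp [Instr.apply, b2, b3, b4, b5, b6]
    rintro s3 ⟨c1, c2, c3, c4, c5, c6, c7, c8⟩
    have h3' : s3.reg 3 = s₀.reg 3 := (c1.reg 3).trans h3
    have final : ∀ s', Agree sortRegs (2 :: 7 :: sortArrs) s s' → s'.rarr = s.rarr →
        s'.reg 4 = h → s'.reg 5 = k → s'.reg 6 = s.reg 8 →
        s'.reg 7 = min (s.reg 8 + h) (s₀.reg 3) → s'.reg 8 = min (s.reg 8 + h) (s₀.reg 3) →
        s'.reg 9 = min (min (s.reg 8 + h) (s₀.reg 3) + h) (s₀.reg 3) →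
        PassInv s₀ h k s' ∧ (s'.reg 6 < s'.reg 7 ∨ s'.reg 8 < s'.reg 9) := by
      intro s' d1 d2 d3 d4 d5 d6 d7 d8
      refine ⟨⟨hs.agree.trans ⟨d1.1, fun a ha => d1.2 a ?_⟩, d2.trans hs.rarr, d3, d4, ?_⟩, ?_⟩
      · rcases List.mem_cons.1 ha with rfl | ha
        · exact .head _
        · exact .tail _ (.tail _ ha)
      · rw [d5, d6, d7, d8, d1.arr 7]
        exact hnew
      · left
        rw [d5, d6]
        omega
    refine Runs.ite (T := 1) (fun hlt => ?_) fun hlt => ?_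
    · change s3.reg 3 < s3.reg 9 at hlt
      rw [h3', c8] at hlt
      exact Runs.instr (final _ (c1.trans (by simp [Agree, Instr.apply]))
        (by simp [Instr.apply, c2]) (by simp [Instr.apply, c3]) (by simp [Instr.apply, c4])
        (by simp [Instr.apply, c5]) (by simp [Instr.apply, c6]) (by simp [Instr.apply, c7])
        (by simp [Instr.apply, h3', hlt.le])) le_rfl
    · change ¬ s3.reg 3 < s3.reg 9 at hlt
      rw [h3', c8, not_lt] at hlt
      exact Runs.skip (final _ c1 c2 c3 c4 c5 c6 c7 (by rw [c8, min_eq_left hlt]))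
  · exact Runs.skip ⟨hs, Or.inr (lt_of_le_of_ne hI.q_le h89)⟩
  · exact Runs.skip ⟨hs, Or.inl (lt_of_le_of_ne hI.p_le h67)⟩

theorem runs_mergeLeft {s : State} (hs : PassInv s₀ h k s) (hone : s₀.reg 1 = 1)
    (hp : s.reg 6 < s.reg 7)
    (hle : s.reg 8 < s.reg 9 →
      s₀.rarr 1 (s₀.arr 2 (s.reg 6)) ≤ s₀.rarr 1 (s₀.arr 2 (s.reg 8))) :
    Runs M mergeLeft s 4 (PassInv s₀ h (k + 1)) := by
  have h1 : s.reg 1 = 1 := (hs.agree.reg 1).trans hone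
  have h2 : s.arr 2 = s₀.arr 2 := hs.agree.arr 2
  refine Runs.block ?_ le_rfl
  refine ⟨hs.agree.trans (by simp [Agree, Instr.apply]), ?_, ?_, ?_, ?_⟩
  · simpa [Instr.apply] using hs.rarr
  · simpa [Instr.apply] using hs.width
  · simp [Instr.apply, hs.counter, h1]
  · simpa [Instr.apply, hs.counter, h1, h2] using hs.merge.take_left hp hle

theorem runs_mergeRight {s : State} (hs : PassInv s₀ h k s) (hone : s₀.reg 1 = 1)
    (hq : s.reg 8 < s.reg 9)
    (hle : s.reg 6 < s.reg 7 →
      s₀.rarr 1 (s₀.arr 2 (s.reg 8)) ≤ s₀.rarr 1 (s₀.arr 2 (s.reg 6))) :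
    Runs M mergeRight s 4 (PassInv s₀ h (k + 1)) := by
  have h1 : s.reg 1 = 1 := (hs.agree.reg 1).trans hone
  have h2 : s.arr 2 = s₀.arr 2 := hs.agree.arr 2
  refine Runs.block ?_ le_rfl
  refine ⟨hs.agree.trans (by simp [Agree, Instr.apply]), ?_, ?_, ?_, ?_⟩
  · simpa [Instr.apply] using hs.rarr
  · simpa [Instr.apply] using hs.width
  · simp [Instr.apply, hs.counter, h1]
  · simpa [Instr.apply, hs.counter, h1, h2] using hs.merge.take_right hq hle

theorem runs_mergeChoose {s : State} (hs : PassInv s₀ h k s) (hone : s₀.reg 1 = 1)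
    (hne : s.reg 6 < s.reg 7 ∨ s.reg 8 < s.reg 9) :
    Runs M mergeChoose s 11 (PassInv s₀ h (k + 1)) := by
  have h2 : s.arr 2 = s₀.arr 2 := hs.agree.arr 2
  refine Runs.ite (T := 10) (fun h67 => Runs.ite (T := 9) (fun h89 => ?_) fun h89 => ?_) fun h67 => ?_
  · refine (Runs.block (T := 4) (Q := fun s' => PassInv s₀ h k s' ∧ s'.reg 6 = s.reg 6 ∧
      s'.reg 7 = s.reg 7 ∧ s'.reg 8 = s.reg 8 ∧ s'.reg 9 = s.reg 9 ∧
      s'.rreg 0 = s₀.rarr 1 (s₀.arr 2 (s.reg 6)) ∧ s'.rreg 1 = s₀.rarr 1 (s₀.arr 2 (s.reg 8)))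
      ?_ le_rfl).seq (U := 5) ?_
    · refine ⟨⟨hs.agree.trans (by simp [Agree, Instr.apply]), ?_, ?_, ?_, ?_⟩, ?_⟩
      · simpa [Instr.apply] using hs.rarr
      · simpa [Instr.apply] using hs.width
      · simpa [Instr.apply] using hs.counter
      · simpa [Instr.apply] using hs.merge
      · simp [Instr.apply, h2, hs.rarr]
    · rintro s' ⟨hs', e6, e7, e8, e9, er0, er1⟩
      change s.reg 6 < s.reg 7 at h67
      change s.reg 8 < s.reg 9 at h89
      refine Runs.ite (T := 4) (fun hlt => runs_mergeRight hs' hone (by omega) fun _ => ?_)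
        fun hlt => runs_mergeLeft hs' hone (by omega) fun _ => ?_
      · change s'.rreg 1 < s'.rreg 0 at hlt
        rw [er0, er1] at hlt
        rw [e6, e8]
        exact hlt.le
      · change ¬ s'.rreg 1 < s'.rreg 0 at hlt
        rw [er0, er1] at hlt
        rw [e6, e8]
        exact not_lt.1 hlt
  · exact (runs_mergeLeft hs hone h67 fun hlt => absurd hlt h89).mono (by norm_num) fun _ => id
  · exact (runs_mergeRight hs hone (hne.resolve_left h67) fun hlt => absurd hlt h67).mono
      (by norm_num) fun _ => id

/-- The invariant of merge sort: blocks of length `h` are sorted. -/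
structure SortInv (s₀ : State) (h : ℕ) (s : State) : Prop where
  agree : Agree sortRegs sortArrs s₀ s
  rarr : s.rarr = s₀.rarr
  width : s.reg 4 = h
  sorted : SortedBlocks (s₀.rarr 1) (s.arr 2) (s₀.reg 3) h
  surj : ∀ x < s₀.reg 3, ∃ j < s₀.reg 3, s.arr 2 j = x

theorem runs_mergePass {s₁ : State} (h1 : s₁.reg 1 = 1) (h2 : s₁.reg 2 = 0) (hh : 0 < h)
    {s : State} (hs : SortInv s₁ h s) :
    Runs M mergePass s (26 * s₁.reg 3 + 9) (SortInv s₁ (2 * h)) := by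
  have hN : s.reg 3 = s₁.reg 3 := hs.agree.reg 3
  have hone : s.reg 1 = 1 := (hs.agree.reg 1).trans h1
  have hzero : s.reg 2 = 0 := (hs.agree.reg 2).trans h2
  have hsort : SortedBlocks (s.rarr 1) (s.arr 2) (s.reg 3) h := by
    rw [hs.rarr, hN]; exact hs.sorted
  -- Each entry costs `22` steps for merging, including the loop test, and `4` for copying back.
  refine Runs.mono (T := 5 + (s.reg 3 * (21 + 1) + 1 + (1 + (s.reg 3 * (3 + 1) + 1 + 1))))
    ?_ (by omega) fun _ => id
  refine (Runs.block (Q := PassInv s h 0) ?_ le_rfl).seq fun s2 hs2 => ?_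
  · refine ⟨by simp [Agree, Instr.apply], by simp [Instr.apply],
      by simpa [Instr.apply] using hs.width, by simp [Instr.apply, hzero], ?_⟩
    simpa [Instr.apply, hzero] using MergeInv.init _ _ _ _ _
  refine (Runs.loop (Inv := PassInv s h) ?_ ?_ hs2).seq fun s3 hs3 => ?_
  · intro k hk s' hs'
    refine ⟨?_, (runs_mergeReset hh hsort hk hs').seq (U := 11) fun s'' hs'' =>
      runs_mergeChoose hs''.1 hone hs''.2⟩
    change s'.reg 5 < s'.reg 3
    rw [hs'.counter, hs'.agree.reg 3]
    exact hk
  · intro s' hs'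
    change ¬ s'.reg 5 < s'.reg 3
    rw [hs'.counter, hs'.agree.reg 3]
    exact lt_irrefl _
  have h32 : s3.reg 2 = 0 := (hs3.agree.reg 2).trans hzero
  refine (Runs.instr (Q := fun s' => s' = _) rfl le_rfl).seq fun s4 hs4 => ?_
  refine (Runs.loop (Inv := fun k s' => Agree sortRegs (7 :: sortArrs) s3 s' ∧ s'.rarr = s.rarr ∧
    s'.reg 4 = h ∧ s'.reg 5 = k ∧ ∀ j < k, s'.arr 2 j = s3.arr 7 j) ?_ ?_ ?_).seq ?_
  · rintro k hk s' ⟨h5, h6, h7, h8, h9⟩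
    have h51 : s'.reg 1 = 1 := (h5.reg 1).trans ((hs3.agree.reg 1).trans hone)
    have h57 : s'.arr 7 = s3.arr 7 := h5.arr 7
    refine ⟨?_, Runs.block ⟨h5.trans (by simp [Agree, Instr.apply]), by simpa [Instr.apply] using h6,
      by simpa [Instr.apply] using h7, by simp [Instr.apply, h8, h51], ?_⟩ le_rfl⟩
    · change s'.reg 5 < s'.reg 3
      rw [h8, h5.reg 3, hs3.agree.reg 3]
      exact hk
    · intro j hj
      simp only [List.foldl, Instr.apply, Function.update_self, ne_eq, Nat.reduceEqDiff,
        not_false_eq_true, Function.update_of_ne, h8, h57]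
      rcases Nat.lt_succ_iff_lt_or_eq.1 hj with hlt | rfl
      · rw [Function.update_of_ne hlt.ne, h9 j hlt]
      · rw [Function.update_self]
  · rintro s' ⟨h5, -, -, h8, -⟩
    change ¬ s'.reg 5 < s'.reg 3
    rw [h8, h5.reg 3, hs3.agree.reg 3]
    exact lt_irrefl _
  · subst hs4
    refine ⟨by simp [Agree, Instr.apply], ?_, ?_, by simp [Instr.apply, h32], by simp⟩
    · simpa [Instr.apply] using hs3.rarr
    · simpa [Instr.apply] using hs3.width
  · rintro s' ⟨h5, h6, h7, h8, h9⟩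
    refine Runs.instr ?_ le_rfl
    have hagree : Agree sortRegs sortArrs s3 s' := ⟨h5.1, fun a ha => h5.2 a (.tail _ ha)⟩
    have hagree' : Agree sortRegs sortArrs s s3 :=
      ⟨hs3.agree.1, fun a ha => hs3.agree.2 a (.tail _ ha)⟩
    refine ⟨hs.agree.trans (hagree'.trans (hagree.trans (by simp [Agree, Instr.apply]))), ?_, ?_,
      ?_, ?_⟩
    · simpa [Instr.apply, h6] using hs.rarr
    · simp [Instr.apply, h7]
      omega
    · have h10 := hs3.merge.sortedBlocks
      rw [hs.rarr, hN] at h10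
      rw [hN] at h9
      intro c i j hi hij hj hjN
      simpa [Instr.apply, h9 i (by omega), h9 j hjN] using h10 c i j hi hij hj hjN
    · intro x hx
      obtain ⟨j, hj, rfl⟩ := hs.surj x hx
      rw [← hN] at hj ⊢
      obtain ⟨i, hi, hij⟩ := hs3.merge.exists_eq hj
      exact ⟨i, hi, by simpa [Instr.apply, h9 i hi] using hij⟩

/-- The identity arrangement has sorted blocks of length `1`, and each pass doubles the length, so
the loop makes exactly `Nat.clog 2 N` passes. -/
theorem runs_mergeSort {s : State} (h1 : s.reg 1 = 1) (h2 : s.reg 2 = 0) :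
    Runs M mergeSort s (3 * s.reg 3 + 4 + Nat.clog 2 (s.reg 3) * (26 * s.reg 3 + 10)) fun s' =>
      Agree sortRegs sortArrs s s' ∧ s'.rarr = s.rarr ∧
        IsSorting (s.rarr 1) (s.reg 3) (s'.arr 2) := by
  refine Runs.mono (T := 1 + ((s.reg 3 * (2 + 1) + 1) + (1 +
    (Nat.clog 2 (s.reg 3) * ((26 * s.reg 3 + 9) + 1) + 1)))) (P := SortInv s (2 ^ Nat.clog 2 (s.reg 3)))
    ?_ (le_of_eq (by ring))
    fun s' hs' => ⟨hs'.agree, hs'.rarr, hs'.sorted.isSorting (Nat.le_pow_clog (by norm_num) _) hs'.surj⟩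
  refine (Runs.instr (Q := fun s' => s' = _) rfl le_rfl).seq fun s2 hs2 => ?_
  refine (Runs.loop (Inv := fun k s' => Agree sortRegs sortArrs s s' ∧ s'.rarr = s.rarr ∧
    s'.reg 5 = k ∧ ∀ j < k, s'.arr 2 j = j) ?_ ?_ ?_).seq ?_
  · rintro k hk s' ⟨h5, h6, h8, h9⟩
    have h51 : s'.reg 1 = 1 := (h5.reg 1).trans h1
    refine ⟨?_, Runs.block ⟨h5.trans (by simp [Agree, Instr.apply]), by simpa [Instr.apply] using h6,
      by simp [Instr.apply, h8, h51], ?_⟩ le_rfl⟩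
    · change s'.reg 5 < s'.reg 3
      rw [h8, h5.reg 3]
      exact hk
    · intro j hj
      simp only [List.foldl, Instr.apply, Function.update_self, h8]
      rcases Nat.lt_succ_iff_lt_or_eq.1 hj with hlt | rfl
      · rw [Function.update_of_ne hlt.ne, h9 j hlt]
      · rw [Function.update_self]
  · rintro s' ⟨h5, -, h8, -⟩
    change ¬ s'.reg 5 < s'.reg 3
    rw [h8, h5.reg 3]
    exact lt_irrefl _
  · subst hs2
    exact ⟨by simp [Agree, Instr.apply], by simp [Instr.apply], by simp [Instr.apply, h2], by simp⟩
  · rintro s' ⟨h5, h6, h8, h9⟩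
    refine (Runs.instr (Q := SortInv s (2 ^ 0)) ?_ le_rfl).seq fun s4 hs4 => ?_
    · refine ⟨h5.trans (by simp [Agree, Instr.apply]), by simpa [Instr.apply] using h6,
        by simp [Instr.apply, h5.reg 1, h1], ?_, fun x hx => ⟨x, hx, h9 x hx⟩⟩
      intro c i j hi hij hj _
      rw [show i = j by omega]
    · refine Runs.loop (Inv := fun k => SortInv s (2 ^ k)) ?_ ?_ hs4
      · intro k hk s' hs'
        refine ⟨?_, ?_⟩
        · change s'.reg 4 < s'.reg 3
          rw [hs'.width, hs'.agree.reg 3]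
          exact (Nat.lt_clog_iff_pow_lt (by norm_num)).1 hk
        · rw [pow_succ']
          exact runs_mergePass h1 h2 (by positivity) hs'
      · intro s' hs'
        change ¬ s'.reg 4 < s'.reg 3
        rw [hs'.width, hs'.agree.reg 3, not_lt]
        exact Nat.le_pow_clog (by norm_num) _

end MergeSort

/-! ### The greedy algorithm -/

/-- The matroid `M` as a matroid on the natural numbers. -/
def natMatroid {n : ℕ} (M : Matroid (Fin n)) : Matroid ℕ := M.mapEmbedding Fin.valEmbedding

/-- The set below `n` with a given characteristic vector. -/
def supp (n : ℕ) (a : ℕ → ℕ) : Set ℕ := {x | x < n ∧ a x ≠ 0}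

section Supp

variable {n : ℕ} {a : ℕ → ℕ} {x : ℕ}

theorem supp_update_one (hx : x < n) : supp n (Function.update a x 1) = insert x (supp n a) := by
  ext y
  by_cases hy : y = x
  · simp [supp, hy, hx]
  · simp [supp, hy]

theorem supp_update_zero : supp n (Function.update a x 0) = supp n a \ {x} := by
  ext y
  by_cases hy : y = x
  · simp [supp, hy]
  · simp [supp, hy]

/-- The oracle reads only entries whose index lies in `Fin n`; the cut-off in `supp` matches this,
so array entries beyond `n` are harmless. -/
theorem holds_indep_iff {M : Matroid (Fin n)} {s : State} {i : ℕ} :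
    (Test.indep i).Holds M s ↔ (natMatroid M).Indep (supp n (s.arr i)) := by
  rw [natMatroid, Matroid.mapEmbedding_indep_iff]
  have h1 : Fin.valEmbedding ⁻¹' supp n (s.arr i) = {e : Fin n | s.arr i e ≠ 0} := by
    ext e
    simp [supp]
  rw [h1, Test.Holds, and_iff_left]
  exact fun y hy => ⟨⟨y, hy.1⟩, rfl⟩

theorem natMatroid_ground {M : Matroid (Fin n)} (hM : M.E = univ) :
    (natMatroid M).E = {x | x < n} := by
  ext x
  simp only [natMatroid, Matroid.mapEmbedding_ground_eq, hM, image_univ, mem_range,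
    Fin.valEmbedding_apply, mem_ofPred_eq]
  exact ⟨fun ⟨y, hy⟩ => hy ▸ y.2, fun hx => ⟨⟨x, hx⟩, rfl⟩⟩

end Supp

/-- `σ` arranges the numbers below `n`, with inverse `pos`. -/
structure IsRanking (n : ℕ) (σ pos : ℕ → ℕ) : Prop where
  lt : ∀ k < n, σ k < n
  pos_apply : ∀ k < n, pos (σ k) = k
  pos_lt : ∀ x < n, pos x < n
  apply_pos : ∀ x < n, σ (pos x) = x

theorem IsRanking.injOn {n : ℕ} {σ pos : ℕ → ℕ} (h : IsRanking n σ pos) :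
    InjOn pos {x | x < n} := fun x hx y hy hxy => by
  rw [← h.apply_pos x hx, hxy, h.apply_pos y hy]

theorem IsSorting.exists_isRanking {key : ℕ → ℝ} {n : ℕ} {σ : ℕ → ℕ} (h : IsSorting key n σ) :
    ∃ pos, IsRanking n σ pos := by
  choose! pos hpos using h.surj
  exact ⟨pos, h.lt, fun k hk => h.injOn (hpos _ (h.lt k hk)).1 hk (hpos _ (h.lt k hk)).2,
    fun x hx => (hpos x hx).1, fun x hx => (hpos x hx).2⟩

/-- `S` is what the greedy algorithm has selected from the elements of `U` of position less
than `k`. -/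
structure GreedyInv {α : Type*} (M : Matroid α) (pos : α → ℕ) (U : Set α) (k : ℕ) (S : Set α) :
    Prop where
  indep : M.Indep S
  subset : S ⊆ U
  pos_lt : ∀ x ∈ S, pos x < k
  span : ∀ x ∈ U, pos x < k → x ∈ M.closure {y | y ∈ S ∧ pos y ≤ pos x}

namespace GreedyInv

variable {α : Type*} {M : Matroid α} {pos : α → ℕ} {U S : Set α} {k : ℕ} {x : α}

theorem zero (M : Matroid α) (pos : α → ℕ) (U : Set α) : GreedyInv M pos U 0 ∅ :=
  ⟨M.empty_indep, empty_subset _, fun _ hx => hx.elim, fun _ _ hx => absurd hx (Nat.not_lt_zero _)⟩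

theorem insert (h : GreedyInv M pos U k S) (hpos : InjOn pos M.E) (hU : U ⊆ M.E) (hxU : x ∈ U)
    (hx : pos x = k) (hind : M.Indep (insert x S)) : GreedyInv M pos U (k + 1) (insert x S) := by
  refine ⟨hind, insert_subset hxU h.subset, ?_, fun y hy hyk => ?_⟩
  · rintro y (rfl | hy)
    · omega
    · exact (h.pos_lt y hy).trans (Nat.lt_succ_self k)
  · rcases Nat.lt_succ_iff_lt_or_eq.1 hyk with hlt | heq
    · refine M.closure_subset_closure ?_ (h.span y hy hlt)
      exact fun z hz => ⟨Or.inr hz.1, hz.2⟩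
    · have hyx : y = x := hpos (hU hy) (hU hxU) (heq.trans hx.symm)
      subst hyx
      exact M.mem_closure_of_mem' (X := {z | z ∈ Insert.insert y S ∧ pos z ≤ pos y})
        ⟨mem_insert _ _, le_rfl⟩ (hU hy)

/-- A rejected element is spanned by `S`, and all of `S` was selected before it. -/
theorem skip (h : GreedyInv M pos U k S) (hpos : InjOn pos M.E) (hU : U ⊆ M.E) (hxU : x ∈ U)
    (hx : pos x = k) (hind : ¬ M.Indep (Insert.insert x S)) : GreedyInv M pos U (k + 1) S := by
  refine ⟨h.indep, h.subset, fun y hy => (h.pos_lt y hy).trans (Nat.lt_succ_self k),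
    fun y hy hyk => ?_⟩
  rcases Nat.lt_succ_iff_lt_or_eq.1 hyk with hlt | heq
  · exact h.span y hy hlt
  · have hyx : y = x := hpos (hU hy) (hU hxU) (heq.trans hx.symm)
    subst hyx
    have hS : {z | z ∈ S ∧ pos z ≤ pos y} = S := by
      ext z
      exact ⟨fun hz => hz.1, fun hz => ⟨hz, heq ▸ (h.pos_lt z hz).le⟩⟩
    rw [hS]
    by_contra hcl
    exact hind (h.indep.insert_indep_iff.2 (Or.inl ⟨hU hy, hcl⟩))

theorem skip_of_notMem (h : GreedyInv M pos U k S) (hpos : InjOn pos M.E) (hU : U ⊆ M.E)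
    (hxE : x ∈ M.E) (hxU : x ∉ U) (hx : pos x = k) : GreedyInv M pos U (k + 1) S := by
  refine ⟨h.indep, h.subset, fun y hy => (h.pos_lt y hy).trans (Nat.lt_succ_self k),
    fun y hy hyk => h.span y hy ?_⟩
  refine lt_of_le_of_ne (Nat.le_of_lt_succ hyk) fun heq => hxU ?_
  rw [← hpos (hU hy) hxE (heq.trans hx.symm)]
  exact hy

theorem isGreedyBasis (h : GreedyInv M pos U k S) (hk : ∀ x ∈ U, pos x < k) :
    IsGreedyBasis M pos U S :=
  ⟨h.indep, h.subset, fun x hx => h.span x hx (hk x hx)⟩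

end GreedyInv

/-- `a 0, …, a (m - 1)` are the elements of `S`, in order of increasing position. -/
structure Enumerates (pos : ℕ → ℕ) (a : ℕ → ℕ) (m : ℕ) (S : Set ℕ) : Prop where
  image : a '' Iio m = S
  mono : ∀ i j, i < j → j < m → pos (a i) < pos (a j)

namespace Enumerates

variable {pos a : ℕ → ℕ} {m : ℕ} {S : Set ℕ} {x : ℕ}

theorem empty (pos a : ℕ → ℕ) : Enumerates pos a 0 ∅ := ⟨by simp, fun i j _ hj => by omega⟩

theorem push (h : Enumerates pos a m S) (hx : ∀ y ∈ S, pos y < pos x) :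
    Enumerates pos (Function.update a m x) (m + 1) (insert x S) := by
  refine ⟨?_, fun i j hij hj => ?_⟩
  · have h1 : Function.update a m x '' Iio m = a '' Iio m :=
      image_congr fun i hi => Function.update_of_ne (ne_of_lt hi) _ _
    have h2 : Iio (m + 1) = insert m (Iio m) := by
      ext i
      simp only [mem_Iio, mem_insert_iff]
      omega
    rw [← h.image, h2, image_insert_eq, h1, Function.update_self]
  · rw [Function.update_of_ne (by omega : i ≠ m)]
    rcases Nat.lt_succ_iff_lt_or_eq.1 hj with hlt | rfl
    · rw [Function.update_of_ne hlt.ne]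
      exact h.mono i j hij hlt
    · rw [Function.update_self]
      exact hx _ (h.image ▸ ⟨i, hij, rfl⟩)

theorem mem (h : Enumerates pos a m S) {i : ℕ} (hi : i < m) : a i ∈ S := h.image ▸ ⟨i, hi, rfl⟩

theorem injOn (h : Enumerates pos a m S) : InjOn a (Iio m) := by
  intro i hi j hj hij
  rcases lt_trichotomy i j with hlt | heq | hgt
  · exact absurd (h.mono i j hlt hj) (by simp [hij])
  · exact heq
  · exact absurd (h.mono j i hgt hi) (by simp [hij])

/-- Positions increase strictly along the list, so it has no repetition and its length is the size
of an independent set. This bounds both the number of exchanges and the number of candidates in each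
by the rank. -/
theorem le_eRank {n : ℕ} {M : Matroid (Fin n)} (h : Enumerates pos a m S)
    (hS : (natMatroid M).Indep S) : m ≤ M.eRank.toNat := by
  rw [natMatroid, Matroid.mapEmbedding_indep_iff] at hS
  have h1 : (m : ℕ∞) ≤ M.eRank := by
    refine le_trans (le_of_eq ?_) hS.1.encard_le_eRank
    rw [← Fin.valEmbedding.injective.encard_image, image_preimage_eq_of_subset hS.2, ← h.image,
      h.injOn.encard_image, ← Finset.coe_Iio,
      encard_coe_eq_coe_finsetCard, Nat.card_Iio]
  have h2 : M.eRank ≠ ⊤ := by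
    rw [Matroid.eRank_ne_top_iff]
    infer_instance
  simpa using ENat.toNat_le_toNat h1 h2

end Enumerates

variable {n : ℕ} {M : Matroid (Fin n)}

/-- Compute the greedy basis of the matroid in array `3`, and list its elements outside the set in
array `0` in array `6`, and their number in register `12`. -/
def greedyAll : Prog :=
  .seq (.instr (.copy 5 2)) (.loop (.lt 5 0)
    (.seq (Prog.block [.load 10 2 5, .load 11 0 10, .store 3 10 1])
      (.seq (.ite (.indep 3)
          (.ite (.eq 11 2) (Prog.block [.store 6 12 10, .add 12 12 1]) .skip)
          (.instr (.store 3 10 2)))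
        (.instr (.add 5 5 1)))))

/-- Compute the greedy basis of the set in array `0` in array `4`, and list its elements in
array `5`, and their number in register `13`. -/
def greedyGiven : Prog :=
  .seq (.instr (.copy 5 2)) (.loop (.lt 5 0)
    (.seq (Prog.block [.load 10 2 5, .load 11 0 10])
      (.seq (.ite (.eq 11 2) .skip
          (.seq (.instr (.store 4 10 1))
            (.ite (.indep 4) (Prog.block [.store 5 13 10, .add 13 13 1])
              (.instr (.store 4 10 2)))))
        (.instr (.add 5 5 1)))))

theorem runs_greedyAll (hM : M.E = univ) {s : State} {pos : ℕ → ℕ} (h0 : s.reg 0 = n)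
    (h1 : s.reg 1 = 1) (h2 : s.reg 2 = 0) (h12 : s.reg 12 = 0) (h3 : ∀ x, s.arr 3 x = 0)
    (hσ : IsRanking n (s.arr 2) pos) :
    Runs M greedyAll s (9 * n + 2) fun s' =>
      Agree [0, 1, 2, 13, 14] [0, 1, 2, 4, 5] s s' ∧ s'.rarr = s.rarr ∧
        IsGreedyBasis (natMatroid M) pos {x | x < n} (supp n (s'.arr 3)) ∧
        Enumerates pos (s'.arr 6) (s'.reg 12) (supp n (s'.arr 3) \ supp n (s.arr 0)) := by
  have hE := natMatroid_ground hM
  have hinj : InjOn pos (natMatroid M).E := hE ▸ hσ.injOn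
  refine Runs.mono (T := 1 + (n * (8 + 1) + 1)) (P := fun s' =>
      Agree [0, 1, 2, 13, 14] [0, 1, 2, 4, 5] s s' ∧ s'.rarr = s.rarr ∧ s'.reg 5 = n ∧
        GreedyInv (natMatroid M) pos {x | x < n} n (supp n (s'.arr 3)) ∧
        Enumerates pos (s'.arr 6) (s'.reg 12) (supp n (s'.arr 3) \ supp n (s.arr 0))) ?_ (by omega)
    fun s' hs' => ⟨hs'.1, hs'.2.1, hs'.2.2.2.1.isGreedyBasis fun x hx => hσ.pos_lt x hx,
      hs'.2.2.2.2⟩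
  refine (Runs.instr (Q := fun s' => s' = _) rfl le_rfl).seq fun s1 hs1 => ?_
  refine Runs.loop (Inv := fun k s' =>
      Agree [0, 1, 2, 13, 14] [0, 1, 2, 4, 5] s s' ∧ s'.rarr = s.rarr ∧ s'.reg 5 = k ∧
        GreedyInv (natMatroid M) pos {x | x < n} k (supp n (s'.arr 3)) ∧
        Enumerates pos (s'.arr 6) (s'.reg 12) (supp n (s'.arr 3) \ supp n (s.arr 0))) ?_ ?_ ?_
  · rintro k hk s2 ⟨a1, a2, a3, a4, a5⟩
    refine ⟨?_, ?_⟩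
    · change s2.reg 5 < s2.reg 0
      rw [a3, a1.reg 0, h0]
      exact hk
    set x := s.arr 2 k with hx
    have hxn : x < n := hσ.lt k hk
    have hxpos : pos x = k := hσ.pos_apply k hk
    have hxS : x ∉ supp n (s2.arr 3) := fun hc => by
      have := a4.pos_lt x hc
      omega
    refine (Runs.block (T := 3) (Q := fun s' => Agree [0, 1, 2, 13, 14] [0, 1, 2, 4, 5] s s' ∧
      s'.rarr = s.rarr ∧ s'.reg 5 = k ∧ s'.reg 10 = x ∧ s'.reg 11 = s.arr 0 x ∧
      s'.reg 12 = s2.reg 12 ∧ s'.arr 6 = s2.arr 6 ∧ s'.arr 3 = Function.update (s2.arr 3) x 1) ?_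
      le_rfl).seq (U := 5) ?_
    · refine ⟨a1.trans (by simp [Agree, Instr.apply]), ?_⟩
      simp [Instr.apply, a2, a3, a1.reg 1, h1, a1.arr 0, a1.arr 2, hx]
    rintro s3 ⟨b1, b2, b3, b4, b5, b6, b7, b8⟩
    refine (Runs.ite (T := 3) (Q := fun s' =>
      Agree [0, 1, 2, 13, 14] [0, 1, 2, 4, 5] s s' ∧ s'.rarr = s.rarr ∧ s'.reg 5 = k ∧
        GreedyInv (natMatroid M) pos {x | x < n} (k + 1) (supp n (s'.arr 3)) ∧
        Enumerates pos (s'.arr 6) (s'.reg 12) (supp n (s'.arr 3) \ supp n (s.arr 0)))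
      (fun hind => ?_) fun hind => ?_).seq (U := 1) ?_
    · rw [holds_indep_iff, b8, supp_update_one hxn] at hind
      have hG := a4.insert hinj hE.ge hxn hxpos hind
      refine Runs.ite (T := 2) (fun heq => ?_) fun heq => ?_
      · change s3.reg 11 = s3.reg 2 at heq
        rw [b5, b1.reg 2, h2] at heq
        refine Runs.block ?_ le_rfl
        refine ⟨b1.trans (by simp [Agree, Instr.apply]), by simpa [Instr.apply] using b2,
          by simpa [Instr.apply] using b3, ?_, ?_⟩
        · simpa [Instr.apply, b8, supp_update_one hxn] using hG
        · have hx0 : x ∉ supp n (s.arr 0) := fun hc => hc.2 heq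
          have := a5.push (x := x) fun y hy => hxpos ▸ a4.pos_lt y hy.1
          rw [← insert_sdiff_of_notMem _ hx0] at this
          simpa [Instr.apply, b8, supp_update_one hxn, b7, b6, b4, b1.reg 1, h1] using this
      · change ¬ s3.reg 11 = s3.reg 2 at heq
        rw [b5, b1.reg 2, h2] at heq
        have hx0 : x ∈ supp n (s.arr 0) := ⟨hxn, heq⟩
        refine Runs.skip ⟨b1, b2, b3, ?_, ?_⟩
        · rwa [b8, supp_update_one hxn]
        · rw [b6, b7, b8, supp_update_one hxn, insert_sdiff_of_mem _ hx0]
          exact a5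
    · rw [holds_indep_iff, b8, supp_update_one hxn] at hind
      have hG := a4.skip hinj hE.ge hxn hxpos hind
      -- The candidate was entered only for the oracle call, so erasing it restores the previous
      -- set.
      have hsupp : supp n (Function.update (s3.arr 3) x 0) = supp n (s2.arr 3) := by
        rw [supp_update_zero, b8, supp_update_one hxn, insert_sdiff_of_mem _ (mem_singleton x),
          sdiff_singleton_eq_self hxS]
      refine Runs.instr ⟨b1.trans (by simp [Agree, Instr.apply]), by simpa [Instr.apply] using b2,
          by simpa [Instr.apply] using b3, ?_, ?_⟩ (by norm_num)
      · simpa [Instr.apply, b1.reg 2, h2, b4, hsupp] using hG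
      · simpa [Instr.apply, b1.reg 2, h2, b4, hsupp, b6, b7] using a5
    · rintro s4 ⟨c1, c2, c3, c4, c5⟩
      refine Runs.instr ⟨c1.trans (by simp [Agree, Instr.apply]), by simpa [Instr.apply] using c2,
          by simp [Instr.apply, c3, c1.reg 1, h1], by simpa [Instr.apply] using c4,
          by simpa [Instr.apply] using c5⟩ le_rfl
  · rintro s' ⟨a1, -, a3, -⟩
    change ¬ s'.reg 5 < s'.reg 0
    rw [a3, a1.reg 0, h0]
    exact lt_irrefl _
  · subst hs1
    have hempty : supp n (s.arr 3) = ∅ := by ext x; simp [supp, h3]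
    refine ⟨by simp [Agree, Instr.apply], by simp [Instr.apply], by simp [Instr.apply, h2], ?_, ?_⟩
    · simpa [Instr.apply, hempty] using GreedyInv.zero _ _ _
    · simpa [Instr.apply, hempty, h12] using Enumerates.empty _ _

theorem runs_greedyGiven (hM : M.E = univ) {s : State} {pos : ℕ → ℕ} (h0 : s.reg 0 = n)
    (h1 : s.reg 1 = 1) (h2 : s.reg 2 = 0) (h13 : s.reg 13 = 0) (h4 : ∀ x, s.arr 4 x = 0)
    (hσ : IsRanking n (s.arr 2) pos) :
    Runs M greedyGiven s (9 * n + 2) fun s' =>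
      Agree [0, 1, 2, 12, 14] [0, 1, 2, 3, 6] s s' ∧ s'.rarr = s.rarr ∧
        IsGreedyBasis (natMatroid M) pos (supp n (s.arr 0)) (supp n (s'.arr 4)) ∧
        Enumerates pos (s'.arr 5) (s'.reg 13) (supp n (s'.arr 4)) := by
  have hE := natMatroid_ground hM
  have hinj : InjOn pos (natMatroid M).E := hE ▸ hσ.injOn
  have hsub : supp n (s.arr 0) ⊆ (natMatroid M).E := hE ▸ fun x hx => hx.1
  refine Runs.mono (T := 1 + (n * (8 + 1) + 1)) (P := fun s' =>
      Agree [0, 1, 2, 12, 14] [0, 1, 2, 3, 6] s s' ∧ s'.rarr = s.rarr ∧ s'.reg 5 = n ∧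
        GreedyInv (natMatroid M) pos (supp n (s.arr 0)) n (supp n (s'.arr 4)) ∧
        Enumerates pos (s'.arr 5) (s'.reg 13) (supp n (s'.arr 4))) ?_ (by omega)
    fun s' hs' => ⟨hs'.1, hs'.2.1, hs'.2.2.2.1.isGreedyBasis fun x hx => hσ.pos_lt x hx.1,
      hs'.2.2.2.2⟩
  refine (Runs.instr (Q := fun s' => s' = _) rfl le_rfl).seq fun s1 hs1 => ?_
  refine Runs.loop (Inv := fun k s' =>
      Agree [0, 1, 2, 12, 14] [0, 1, 2, 3, 6] s s' ∧ s'.rarr = s.rarr ∧ s'.reg 5 = k ∧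
        GreedyInv (natMatroid M) pos (supp n (s.arr 0)) k (supp n (s'.arr 4)) ∧
        Enumerates pos (s'.arr 5) (s'.reg 13) (supp n (s'.arr 4))) ?_ ?_ ?_
  · rintro k hk s2 ⟨a1, a2, a3, a4, a5⟩
    refine ⟨?_, ?_⟩
    · change s2.reg 5 < s2.reg 0
      rw [a3, a1.reg 0, h0]
      exact hk
    set x := s.arr 2 k with hx
    have hxn : x < n := hσ.lt k hk
    have hxpos : pos x = k := hσ.pos_apply k hk
    have hxS : x ∉ supp n (s2.arr 4) := fun hc => by
      have := a4.pos_lt x hc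
      omega
    refine (Runs.block (T := 2) (Q := fun s' => Agree [0, 1, 2, 12, 14] [0, 1, 2, 3, 6] s s' ∧
      s'.rarr = s.rarr ∧ s'.reg 5 = k ∧ s'.reg 10 = x ∧ s'.reg 11 = s.arr 0 x ∧
      s'.reg 13 = s2.reg 13 ∧ s'.arr 5 = s2.arr 5 ∧ s'.arr 4 = s2.arr 4) ?_ le_rfl).seq (U := 6) ?_
    · refine ⟨a1.trans (by simp [Agree, Instr.apply]), ?_⟩
      simp [Instr.apply, a2, a3, a1.arr 0, a1.arr 2, hx]
    rintro s3 ⟨b1, b2, b3, b4, b5, b6, b7, b8⟩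
    refine (Runs.ite (T := 4) (Q := fun s' =>
      Agree [0, 1, 2, 12, 14] [0, 1, 2, 3, 6] s s' ∧ s'.rarr = s.rarr ∧ s'.reg 5 = k ∧
        GreedyInv (natMatroid M) pos (supp n (s.arr 0)) (k + 1) (supp n (s'.arr 4)) ∧
        Enumerates pos (s'.arr 5) (s'.reg 13) (supp n (s'.arr 4)))
      (fun heq => ?_) fun heq => ?_).seq (U := 1) ?_
    · change s3.reg 11 = s3.reg 2 at heq
      rw [b5, b1.reg 2, h2] at heq
      refine Runs.skip ⟨b1, b2, b3, ?_, ?_⟩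
      · rw [b8]
        exact a4.skip_of_notMem hinj hsub (hE.ge hxn) (fun hc => hc.2 heq) hxpos
      · rwa [b6, b7, b8]
    · change ¬ s3.reg 11 = s3.reg 2 at heq
      rw [b5, b1.reg 2, h2] at heq
      have hx0 : x ∈ supp n (s.arr 0) := ⟨hxn, heq⟩
      refine (Runs.instr (T := 1) (Q := fun s' => Agree [0, 1, 2, 12, 14] [0, 1, 2, 3, 6] s s' ∧
        s'.rarr = s.rarr ∧ s'.reg 5 = k ∧ s'.reg 10 = x ∧
        s'.reg 13 = s2.reg 13 ∧ s'.arr 5 = s2.arr 5 ∧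
        s'.arr 4 = Function.update (s2.arr 4) x 1) ?_ le_rfl).seq (U := 3) ?_
      · refine ⟨b1.trans (by simp [Agree, Instr.apply]), ?_⟩
        simp [Instr.apply, b2, b3, b4, b6, b7, b8, b1.reg 1, h1]
      rintro s4 ⟨c1, c2, c3, c4, c5, c6, c7⟩
      refine Runs.ite (T := 2) (fun hind => ?_) fun hind => ?_
      · rw [holds_indep_iff, c7, supp_update_one hxn] at hind
        have hG := a4.insert hinj hsub hx0 hxpos hind
        refine Runs.block ?_ le_rfl
        refine ⟨c1.trans (by simp [Agree, Instr.apply]), by simpa [Instr.apply] using c2,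
          by simpa [Instr.apply] using c3, ?_, ?_⟩
        · simpa [Instr.apply, c7, supp_update_one hxn] using hG
        · have := a5.push (x := x) fun y hy => hxpos ▸ a4.pos_lt y hy
          simpa [Instr.apply, c7, supp_update_one hxn, c6, c5, c4, c1.reg 1, h1] using this
      · rw [holds_indep_iff, c7, supp_update_one hxn] at hind
        have hG := a4.skip hinj hsub hx0 hxpos hind
        have hsupp : supp n (Function.update (s4.arr 4) x 0) = supp n (s2.arr 4) := by
          rw [supp_update_zero, c7, supp_update_one hxn, insert_sdiff_of_mem _ (mem_singleton x),
            sdiff_singleton_eq_self hxS]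
        refine Runs.instr ⟨c1.trans (by simp [Agree, Instr.apply]),
          by simpa [Instr.apply] using c2, by simpa [Instr.apply] using c3, ?_, ?_⟩ (by norm_num)
        · simpa [Instr.apply, c1.reg 2, h2, c4, hsupp] using hG
        · simpa [Instr.apply, c1.reg 2, h2, c4, hsupp, c5, c6] using a5
    · rintro s4 ⟨c1, c2, c3, c4, c5⟩
      refine Runs.instr ⟨c1.trans (by simp [Agree, Instr.apply]), by simpa [Instr.apply] using c2,
          by simp [Instr.apply, c3, c1.reg 1, h1], by simpa [Instr.apply] using c4,
          by simpa [Instr.apply] using c5⟩ le_rfl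
  · rintro s' ⟨a1, -, a3, -⟩
    change ¬ s'.reg 5 < s'.reg 0
    rw [a3, a1.reg 0, h0]
    exact lt_irrefl _
  · subst hs1
    have hempty : supp n (s.arr 4) = ∅ := by ext x; simp [supp, h4]
    refine ⟨by simp [Agree, Instr.apply], by simp [Instr.apply], by simp [Instr.apply, h2], ?_, ?_⟩
    · simpa [Instr.apply, hempty] using GreedyInv.zero _ _ _
    · simpa [Instr.apply, hempty, h13] using Enumerates.empty _ _

/-! ### The exchanges -/

/-- The fundamental circuit of `x` cannot lie inside the independent set `K`. With the inserted
elements `f` as `K`, this yields a removable element of `X`. -/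
theorem exists_exchange {α : Type*} {M : Matroid α} {B K : Set α} {x : α} (hB : M.IsBase B)
    (hxE : x ∈ M.E) (hxB : x ∉ B) (hK : M.Indep K) (hxK : x ∈ K) :
    ∃ y ∈ B, y ∉ K ∧ M.Indep (insert x B \ {y}) := by
  have hC := hB.fundCircuit_isCircuit hxE hxB
  obtain ⟨y, hyC, hyK⟩ := not_subset.1 fun hsub => hC.not_indep (hK.subset hsub)
  have hyB : y ∈ B := by
    rcases M.fundCircuit_subset_insert _ _ hyC with rfl | hy
    · exact absurd hxK hyK
    · exact hy
  exact ⟨y, hyB, hyK, (hB.indep.mem_fundCircuit_iff (by rw [hB.closure_eq]; exact hxE) hxB).1 hyC⟩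

/-- The element `e i` is the last one of `X` that can be swapped for `f i`. -/
def IsLastSwap {α : Type*} (M : Matroid α) (pos : α → ℕ) (X : Set α) (e f : ℕ → α) (i : ℕ) : Prop :=
  e i ∈ X ∧ M.Indep (insert (f i) (exchanged X e f i) \ {e i}) ∧
    ∀ y ∈ X, M.Indep (insert (f i) (exchanged X e f i) \ {y}) → pos y ≤ pos (e i)

/-- Look for the last element in array `5` that can be removed from the set in array `4` to make it
independent, and put it into register `15`. -/
def findLast : Prog :=
  .loop (.lt 5 13)
    (.seq (Prog.block [.load 11 5 5, .load 16 4 11, .store 4 11 2])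
      (.seq (.ite (.indep 4) (.instr (.copy 15 11)) .skip)
        (Prog.block [.store 4 11 16, .add 5 5 1])))

/-- Swap the elements in array `6` successively into the basis in array `4`, and store the changes
of weight in real array `1`. -/
def exchangeAll : Prog :=
  .loop (.lt 14 12)
    (.seq (Prog.block [.load 10 6 14, .store 4 10 1, .copy 5 2])
      (.seq findLast
        (Prog.block [.store 4 15 2, .rload 0 0 10, .rload 1 0 15, .rsub 0 0 1, .rstore 1 14 0,
          .add 14 14 1])))

/-- Each candidate is cleared, tested and restored to its saved value, which is `0` if it has
already been swapped out. The list is ordered by position, so the last success is the required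
maximum; `hex` guarantees that register `15` is actually overwritten. -/
theorem runs_findLast {s : State} {X : Set ℕ} {pos : ℕ → ℕ} (h1 : s.reg 1 = 1) (h2 : s.reg 2 = 0)
    (h5 : s.reg 5 = 0) (hX : Enumerates pos (s.arr 5) (s.reg 13) X)
    (hex : ∃ y ∈ X, (natMatroid M).Indep (supp n (s.arr 4) \ {y})) :
    Runs M findLast s (8 * s.reg 13 + 1) fun s' =>
      Agree [0, 1, 2, 10, 12, 13, 14] [0, 1, 2, 3, 4, 5, 6] s s' ∧ s'.rarr = s.rarr ∧
        s'.reg 15 ∈ X ∧ (natMatroid M).Indep (supp n (s.arr 4) \ {s'.reg 15}) ∧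
        ∀ y ∈ X, (natMatroid M).Indep (supp n (s.arr 4) \ {y}) → pos y ≤ pos (s'.reg 15) := by
  set good : ℕ → Prop := fun j => (natMatroid M).Indep (supp n (s.arr 4) \ {s.arr 5 j}) with hgood
  refine Runs.mono (T := s.reg 13 * (7 + 1) + 1) (P := fun s' =>
      Agree [0, 1, 2, 10, 12, 13, 14] [0, 1, 2, 3, 4, 5, 6] s s' ∧ s'.rarr = s.rarr ∧
        s'.reg 5 = s.reg 13 ∧ ((∃ j < s.reg 13, good j) →
          ∃ i < s.reg 13, s'.reg 15 = s.arr 5 i ∧ good i ∧ ∀ j < s.reg 13, good j → j ≤ i))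
    ?_ (by omega) ?_
  · refine Runs.loop (Inv := fun k s' =>
      Agree [0, 1, 2, 10, 12, 13, 14] [0, 1, 2, 3, 4, 5, 6] s s' ∧ s'.rarr = s.rarr ∧
        s'.reg 5 = k ∧ ((∃ j < k, good j) →
          ∃ i < k, s'.reg 15 = s.arr 5 i ∧ good i ∧ ∀ j < k, good j → j ≤ i)) ?_ ?_ ?_
    · rintro k hk s2 ⟨a1, a2, a3, a4⟩
      refine ⟨?_, ?_⟩
      · change s2.reg 5 < s2.reg 13
        rw [a3, a1.reg 13]
        exact hk
      set x := s.arr 5 k with hx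
      refine (Runs.block (T := 3) (Q := fun s' =>
        Agree [0, 1, 2, 10, 12, 13, 14] [0, 1, 2, 3, 5, 6] s s' ∧
        s'.rarr = s.rarr ∧ s'.reg 5 = k ∧ s'.reg 11 = x ∧ s'.reg 15 = s2.reg 15 ∧
        s'.reg 16 = s.arr 4 x ∧ s'.arr 4 = Function.update (s.arr 4) x 0) ?_ le_rfl).seq (U := 4) ?_
      · have b1 : Agree [0, 1, 2, 10, 12, 13, 14] [0, 1, 2, 3, 5, 6] s s2 :=
          ⟨a1.1, fun a ha => a1.2 a (by simp at ha ⊢; omega)⟩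
        refine ⟨b1.trans (by simp [Agree, Instr.apply]), ?_⟩
        simp [Instr.apply, a2, a3, a1.reg 2, h2, a1.arr 4, a1.arr 5, hx]
      rintro s3 ⟨b1, b2, b3, b4, b5, b6, b7⟩
      have hiff : (Test.indep 4).Holds M s3 ↔ good k := by
        rw [holds_indep_iff, b7, supp_update_zero]
      refine (Runs.ite (T := 1) (Q := fun s' =>
        Agree [0, 1, 2, 10, 12, 13, 14] [0, 1, 2, 3, 5, 6] s s' ∧
        s'.rarr = s.rarr ∧ s'.reg 5 = k ∧ s'.reg 11 = x ∧ s'.reg 16 = s.arr 4 x ∧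
        s'.arr 4 = Function.update (s.arr 4) x 0 ∧ ((∃ j < k + 1, good j) →
          ∃ i < k + 1, s'.reg 15 = s.arr 5 i ∧ good i ∧ ∀ j < k + 1, good j → j ≤ i))
        (fun hind => ?_) fun hind => ?_).seq (U := 2) ?_
      · refine Runs.instr ⟨b1.trans (by simp [Agree, Instr.apply]), by simpa [Instr.apply] using b2,
          by simpa [Instr.apply] using b3, by simpa [Instr.apply] using b4,
          by simpa [Instr.apply] using b6, by simpa [Instr.apply] using b7, fun _ =>
          ⟨k, Nat.lt_succ_self k, by simp [Instr.apply, b4, hx], hiff.1 hind, fun j hj _ => by omega⟩⟩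
          le_rfl
      · have hbad : ¬ good k := fun hc => hind (hiff.2 hc)
        refine Runs.skip ⟨b1, b2, b3, b4, b6, b7, ?_⟩
        rintro ⟨j, hj, hjg⟩
        have hjk : j < k := lt_of_le_of_ne (Nat.le_of_lt_succ hj) fun hc => hbad (hc ▸ hjg)
        obtain ⟨i, hi, hi1, hi2, hi3⟩ := a4 ⟨j, hjk, hjg⟩
        refine ⟨i, hi.trans (Nat.lt_succ_self k), b5.trans hi1, hi2, fun l hl hlg => ?_⟩
        exact hi3 l (lt_of_le_of_ne (Nat.le_of_lt_succ hl) fun hc => hbad (hc ▸ hlg)) hlg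
      · rintro s4 ⟨c1, c2, c3, c4, c5, c6, c7⟩
        refine Runs.block ⟨⟨?_, ?_⟩, by simpa [Instr.apply] using c2,
          by simp [Instr.apply, c3, c1.reg 1, h1], by simpa [Instr.apply] using c7⟩ le_rfl
        · refine (c1.trans (s'' := List.foldl _ _ _) ?_).1
          simp [Agree, Instr.apply]
        · have := c1.2
          simpa [Instr.apply, c4, c5, c6] using this
    · rintro s' ⟨a1, -, a3, -⟩
      change ¬ s'.reg 5 < s'.reg 13
      rw [a3, a1.reg 13]
      exact lt_irrefl _
    · exact ⟨Agree.refl _ _ _, rfl, h5, fun ⟨j, hj, _⟩ => absurd hj (Nat.not_lt_zero _)⟩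
  · rintro s' ⟨a1, a2, a3, a4⟩
    obtain ⟨y, hyX, hy⟩ := hex
    rw [← hX.image] at hyX
    obtain ⟨j, hj, rfl⟩ := hyX
    obtain ⟨i, hi, hi1, hi2, hi3⟩ := a4 ⟨j, hj, hy⟩
    refine ⟨a1, a2, hi1 ▸ hX.mem hi, hi1 ▸ hi2, fun z hzX hz => ?_⟩
    rw [← hX.image] at hzX
    obtain ⟨l, hl, rfl⟩ := hzX
    rw [hi1]
    rcases (hi3 l hl hz).eq_or_lt with rfl | hlt
    · exact le_rfl
    · exact (hX.mono l i hlt hi).le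

/-- The machine keeps no list of the `e i`; they live only in the invariant, which extends the
function `e` by one value per round. The stored numbers are negated gains, so that sorting them
increasingly lists the largest gain first. -/
theorem runs_exchangeAll (hM : M.E = univ) {s : State} {pos : ℕ → ℕ} (h1 : s.reg 1 = 1)
    (h2 : s.reg 2 = 0) (h14 : s.reg 14 = 0)
    (hX : Enumerates pos (s.arr 5) (s.reg 13) (supp n (s.arr 4)))
    (hbase : (natMatroid M).IsBase (supp n (s.arr 4)))
    (hf : (natMatroid M).Indep (s.arr 6 '' Iio (s.reg 12)))
    (hfX : ∀ i < s.reg 12, s.arr 6 i ∉ supp n (s.arr 4)) (hinj : InjOn (s.arr 6) (Iio (s.reg 12))) :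
    Runs M exchangeAll s (s.reg 12 * (8 * s.reg 13 + 11) + 1) fun s' =>
      Agree [0, 1, 2, 12, 13] [0, 1, 2, 3, 5, 6] s s' ∧
        ∃ e : ℕ → ℕ, (∀ i < s.reg 12,
          IsLastSwap (natMatroid M) pos (supp n (s.arr 4)) e (s.arr 6) i) ∧
          ∀ i < s.reg 12, s'.rarr 1 i = s.rarr 0 (s.arr 6 i) - s.rarr 0 (e i) := by
  set f := s.arr 6 with hf_def
  set m := s.reg 12 with hm_def
  set X := supp n (s.arr 4) with hX_def
  set N := natMatroid M with hN_def
  have hE : N.E = {x | x < n} := natMatroid_ground hM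
  have hfE : ∀ i < m, f i ∈ N.E := fun i hi => hf.subset_ground ⟨i, hi, rfl⟩
  refine Runs.mono (T := m * ((8 * s.reg 13 + 10) + 1) + 1) (P := fun s' =>
      Agree [0, 1, 2, 12, 13] [0, 1, 2, 3, 5, 6] s s' ∧ s'.rarr 0 = s.rarr 0 ∧ s'.reg 14 = m ∧
        ∃ e : ℕ → ℕ, supp n (s'.arr 4) = exchanged X e f m ∧ N.IsBase (exchanged X e f m) ∧
          (∀ i < m, IsLastSwap N pos X e f i) ∧
          ∀ i < m, s'.rarr 1 i = s.rarr 0 (f i) - s.rarr 0 (e i)) ?_ le_rfl ?_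
  swap
  · rintro s' ⟨a1, -, -, e, -, -, a4, a5⟩
    exact ⟨a1, e, a4, a5⟩
  refine Runs.loop (Inv := fun k s' =>
      Agree [0, 1, 2, 12, 13] [0, 1, 2, 3, 5, 6] s s' ∧ s'.rarr 0 = s.rarr 0 ∧ s'.reg 14 = k ∧
        ∃ e : ℕ → ℕ, supp n (s'.arr 4) = exchanged X e f k ∧ N.IsBase (exchanged X e f k) ∧
          (∀ i < k, IsLastSwap N pos X e f i) ∧
          ∀ i < k, s'.rarr 1 i = s.rarr 0 (f i) - s.rarr 0 (e i)) ?_ ?_ ?_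
  · rintro k hk s2 ⟨a1, a2, a3, e, a4, a5, a6, a7⟩
    refine ⟨?_, ?_⟩
    · change s2.reg 14 < s2.reg 12
      rw [a3, a1.reg 12]
      exact hk
    have hfn : f k < n := hE.le (hfE k hk)
    have hfB : f k ∉ exchanged X e f k := by
      rintro (⟨hx, -⟩ | ⟨j, hj, hjk⟩)
      · exact hfX k hk hx
      · exact absurd (hinj (lt_trans hj hk) hk hjk) (ne_of_lt hj)
    refine Runs.mono (T := 3 + ((8 * s.reg 13 + 1) + 6)) ?_ (by omega) fun _ => id
    refine (Runs.block (T := 3) (Q := fun s' => Agree [0, 1, 2, 12, 13] [0, 1, 2, 3, 5, 6] s s' ∧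
      s'.rarr = s2.rarr ∧ s'.reg 5 = 0 ∧ s'.reg 10 = f k ∧ s'.reg 14 = k ∧
      s'.arr 4 = Function.update (s2.arr 4) (f k) 1) ?_ le_rfl).seq ?_
    · refine ⟨a1.trans (by simp [Agree, Instr.apply]), ?_⟩
      simp [Instr.apply, a3, a1.reg 1, a1.reg 2, h1, h2, a1.arr 6, hf_def]
    rintro s3 ⟨b1, b2, b3, b4, b5, b6⟩
    have hsupp : supp n (s3.arr 4) = insert (f k) (exchanged X e f k) := by
      rw [b6, supp_update_one hfn, a4]
    have hrun := runs_findLast (M := M) (s := s3) (X := X) (pos := pos) ((b1.reg 1).trans h1)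
      ((b1.reg 2).trans h2) b3 (by rw [b1.arr 5, b1.reg 13]; exact hX) (by
        rw [hsupp]
        -- An element of the current basis that is none of `f 0, …, f k` comes from `X`, where the
        -- search takes place.
        obtain ⟨y, hyB, hyK, hy⟩ := exists_exchange a5 (hfE k hk) hfB
          (hf.subset (image_mono (fun j (hj : j ∈ Iio (k + 1)) =>
            (lt_of_lt_of_le hj hk : j < m)))) ⟨k, Nat.lt_succ_self k, rfl⟩
        rcases hyB with hyX | ⟨j, hj, rfl⟩
        · exact ⟨y, hyX.1, hy⟩
        · exact absurd ⟨j, Nat.lt_succ_of_lt hj, rfl⟩ hyK)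
    rw [b1.reg 13, hsupp] at hrun
    refine hrun.seq ?_
    rintro s4 ⟨c1, c2, c3, c4, c5⟩
    set y := s4.reg 15 with hy_def
    set e' := Function.update e k y with he'_def
    have he' : ∀ j < k, e j = e' j := fun j hj => (Function.update_of_ne hj.ne _ _).symm
    have he'k : e' k = y := Function.update_self _ _ _
    -- The set after `j` exchanges involves only values of `e` below `j`, so setting the value at
    -- `k` leaves the earlier swaps intact.
    have hexch : ∀ j ≤ k, exchanged X e f j = exchanged X e' f j := fun j hj =>
      exchanged_congr fun i hi => he' i (by omega)
    have hyf : ∀ j ≤ k, f j ≠ e' k := by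
      intro j hj hc
      refine hfX j (by omega) ?_
      rw [hc, he'k]
      exact c3
    have hsucc : exchanged X e' f (k + 1) = insert (f k) (exchanged X e f k) \ {y} := by
      rw [exchanged_succ hyf, ← hexch k le_rfl, he'k]
    have hyB : y ∈ exchanged X e f k := by
      by_contra hne
      rw [sdiff_singleton_eq_self] at c4
      · have := a5.eq_of_subset_indep c4 (subset_insert _ _)
        exact hfB (this ▸ mem_insert _ _)
      · rintro (hc | hc)
        · exact hyf k le_rfl (by rw [he'k, hc])
        · exact hne hc
    have d1 : Agree [0, 1, 2, 12, 13] [0, 1, 2, 3, 5, 6] s s4 :=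
      b1.trans ⟨fun i hi => c1.1 i (by simp at hi ⊢; omega),
        fun i hi => c1.2 i (by simp at hi ⊢; omega)⟩
    refine Runs.block ⟨d1.trans (by simp [Agree, Instr.apply]), ?_, ?_, e', ?_, ?_, ?_, ?_⟩ le_rfl
    · simp [Instr.apply, c2, b2, a2]
    · simp [Instr.apply, c1.reg 14, b5, d1.reg 1, h1]
    · rw [hsucc, ← hsupp, ← c1.arr 4, ← supp_update_zero]
      simp [Instr.apply, d1.reg 2, h2, hy_def]
    · rw [hsucc]
      exact a5.exchange_isBase_of_indep' hyB hfB c4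
    · intro j hj
      rcases Nat.lt_succ_iff_lt_or_eq.1 hj with hlt | rfl
      · have := a6 j hlt
        rwa [IsLastSwap, hexch j hlt.le, he' j hlt] at this
      · rw [IsLastSwap, ← hexch j le_rfl, he'k]
        exact ⟨c3, c4, c5⟩
    · intro j hj
      rcases Nat.lt_succ_iff_lt_or_eq.1 hj with hlt | rfl
      · rw [← he' j hlt, ← a7 j hlt]
        simp [Instr.apply, c1.reg 14, b5, c2, b2, hlt.ne]
      · rw [he'k]
        simp [Instr.apply, c1.reg 14, b5, c2, b2, a2, c1.reg 10, b4, hy_def]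
  · rintro s' ⟨a1, -, a3, -⟩
    change ¬ s'.reg 14 < s'.reg 12
    rw [a3, a1.reg 12]
    exact lt_irrefl _
  · have h0 : exchanged X (fun _ => 0) f 0 = X := exchanged_zero _ _ _
    exact ⟨Agree.refl _ _ _, rfl, h14, fun _ => 0, h0.symm, h0.symm ▸ hbase,
      fun _ hi => absurd hi (Nat.not_lt_zero _), fun _ hi => absurd hi (Nat.not_lt_zero _)⟩

/-! ### The output -/

/-- Write the elements in array `6` into array `1`, in order of increasing keys in real array `1`. -/
def outputSwaps : Prog :=
  .seq (.instr (.copy 3 12))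
    (.seq mergeSort
      (.seq (.instr (.copy 5 2))
        (.loop (.lt 5 12) (Prog.block [.load 10 2 5, .load 11 6 10, .store 1 5 11, .add 5 5 1]))))

/-- Append the elements that are neither in the set in array `0` nor in the set in array `3` to the
list in array `1` of length register `12`. -/
def outputRest : Prog :=
  .seq (.instr (.copy 5 2)) (.loop (.lt 5 0)
    (.seq (Prog.block [.load 10 0 5, .load 11 3 5])
      (.seq (.ite (.eq 10 2)
          (.ite (.eq 11 2) (Prog.block [.store 1 12 5, .add 12 12 1]) .skip) .skip)
        (.instr (.add 5 5 1)))))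

/-- Copy the weights into real array `1`. -/
def copyWeights : Prog :=
  .seq (.instr (.copy 5 2))
    (.loop (.lt 5 0) (Prog.block [.rload 0 0 5, .rstore 1 5 0, .add 5 5 1]))

/-- The time that sorting takes. -/
def sortTime (N : ℕ) : ℕ := 3 * N + 4 + Nat.clog 2 N * (26 * N + 10)

theorem sortTime_mono {N N' : ℕ} (h : N ≤ N') : sortTime N ≤ sortTime N' := by
  unfold sortTime
  gcongr

theorem runs_copyWeights {s : State} (h1 : s.reg 1 = 1) (h2 : s.reg 2 = 0) :
    Runs M copyWeights s (4 * s.reg 0 + 2) fun s' =>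
      Agree [0, 1, 2, 12, 13, 14] [0, 1, 3, 4] s s' ∧ s'.rarr 0 = s.rarr 0 ∧
        ∀ j < s.reg 0, s'.rarr 1 j = s.rarr 0 j := by
  refine Runs.mono (T := 1 + (s.reg 0 * (3 + 1) + 1)) (P := fun s' =>
    Agree [0, 1, 2, 12, 13, 14] [0, 1, 3, 4] s s' ∧ s'.rarr 0 = s.rarr 0 ∧ s'.reg 5 = s.reg 0 ∧
      ∀ j < s.reg 0, s'.rarr 1 j = s.rarr 0 j) ?_ (by omega)
    fun s' hs' => ⟨hs'.1, hs'.2.1, hs'.2.2.2⟩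
  refine (Runs.instr (Q := fun s' => s' = _) rfl le_rfl).seq fun s1 hs1 => ?_
  refine Runs.loop (Inv := fun k s' => Agree [0, 1, 2, 12, 13, 14] [0, 1, 3, 4] s s' ∧
    s'.rarr 0 = s.rarr 0 ∧ s'.reg 5 = k ∧ ∀ j < k, s'.rarr 1 j = s.rarr 0 j) ?_ ?_ ?_
  · rintro k hk s' ⟨a1, a2, a3, a4⟩
    refine ⟨?_, Runs.block ⟨a1.trans (by simp [Agree, Instr.apply]), by simpa [Instr.apply] using a2,
      by simp [Instr.apply, a3, a1.reg 1, h1], ?_⟩ le_rfl⟩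
    · change s'.reg 5 < s'.reg 0
      rw [a3, a1.reg 0]
      exact hk
    · intro j hj
      rcases Nat.lt_succ_iff_lt_or_eq.1 hj with hlt | rfl
      · simp [Instr.apply, a3, hlt.ne, a4 j hlt]
      · simp [Instr.apply, a3, a2]
  · rintro s' ⟨a1, -, a3, -⟩
    change ¬ s'.reg 5 < s'.reg 0
    rw [a3, a1.reg 0]
    exact lt_irrefl _
  · subst hs1
    exact ⟨by simp [Agree, Instr.apply], by simp [Instr.apply], by simp [Instr.apply, h2], by simp⟩

/-- What is sorted are the indices of the swaps, which array `6` then translates into elements. -/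
theorem runs_outputSwaps {s : State} (h1 : s.reg 1 = 1) (h2 : s.reg 2 = 0) :
    Runs M outputSwaps s (sortTime (s.reg 12) + 5 * s.reg 12 + 3) fun s' =>
      Agree [0, 1, 2, 12] [0, 3] s s' ∧ ∃ σ, IsSorting (s.rarr 1) (s.reg 12) σ ∧
        ∀ j < s.reg 12, s'.arr 1 j = s.arr 6 (σ j) := by
  refine Runs.mono (T := 1 + (sortTime (s.reg 12) + (1 + (s.reg 12 * (4 + 1) + 1)))) ?_ (by omega)
    fun _ => id
  refine (Runs.instr (Q := fun s' => Agree [0, 1, 2, 12] [0, 3, 6] s s' ∧ s'.rarr = s.rarr ∧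
    s'.reg 3 = s.reg 12) (by simp [Agree, Instr.apply]) le_rfl).seq ?_
  rintro s1 ⟨a1, a2, a3⟩
  have hrun := runs_mergeSort (M := M) ((a1.reg 1).trans h1) ((a1.reg 2).trans h2)
  rw [a2, a3] at hrun
  refine hrun.seq (T := sortTime (s.reg 12)) ?_
  rintro s2 ⟨b1, b2, b3⟩
  have c1 : Agree [0, 1, 2, 12] [0, 3, 6] s s2 :=
    a1.trans ⟨fun i hi => b1.1 i (by simp at hi ⊢; omega), fun i hi => b1.2 i (by simp at hi ⊢; omega)⟩
  refine (Runs.instr (Q := fun s' => s' = _) rfl le_rfl).seq fun s3 hs3 => ?_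
  refine Runs.mono (P := fun s' => Agree [0, 1, 2, 12] [0, 3, 6] s s' ∧ s'.arr 2 = s2.arr 2 ∧
    s'.reg 5 = s.reg 12 ∧ ∀ j < s.reg 12, s'.arr 1 j = s.arr 6 (s2.arr 2 j)) ?_ le_rfl
    fun s' hs' => ⟨⟨hs'.1.1, fun a ha => hs'.1.2 a (by simp at ha ⊢; omega)⟩, _, b3, hs'.2.2.2⟩
  refine Runs.loop (Inv := fun k s' => Agree [0, 1, 2, 12] [0, 3, 6] s s' ∧
    s'.arr 2 = s2.arr 2 ∧ s'.reg 5 = k ∧ ∀ j < k, s'.arr 1 j = s.arr 6 (s2.arr 2 j)) ?_ ?_ ?_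
  · rintro k hk s' ⟨d1, d2, d3, d4⟩
    refine ⟨?_, Runs.block ⟨d1.trans (by simp [Agree, Instr.apply]), by simpa [Instr.apply] using d2,
      by simp [Instr.apply, d3, d1.reg 1, h1], ?_⟩ le_rfl⟩
    · change s'.reg 5 < s'.reg 12
      rw [d3, d1.reg 12]
      exact hk
    · intro j hj
      rcases Nat.lt_succ_iff_lt_or_eq.1 hj with hlt | rfl
      · simp [Instr.apply, d3, hlt.ne, d4 j hlt]
      · simp [Instr.apply, d3, d2, d1.arr 6]
  · rintro s' ⟨d1, -, d3, -⟩
    change ¬ s'.reg 5 < s'.reg 12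
    rw [d3, d1.reg 12]
    exact lt_irrefl _
  · subst hs3
    exact ⟨c1.trans (by simp [Agree, Instr.apply]), by simp [Instr.apply],
      by simp [Instr.apply, c1.reg 2, h2], by simp⟩

theorem injOn_image_update {a : ℕ → ℕ} {l x : ℕ} {S : Set ℕ} (ha : InjOn a (Iio l))
    (hS : a '' Iio l = S) (hx : x ∉ S) :
    InjOn (Function.update a l x) (Iio (l + 1)) ∧
      Function.update a l x '' Iio (l + 1) = insert x S := by
  have h1 : ∀ i < l, Function.update a l x i = a i := fun i hi => Function.update_of_ne hi.ne _ _
  have h2 : Iio (l + 1) = insert l (Iio l) := by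
    ext i
    simp only [mem_Iio, mem_insert_iff]
    omega
  have h3 : Function.update a l x '' Iio l = S := hS ▸ image_congr h1
  constructor
  · rw [h2, injOn_insert (by simp)]
    refine ⟨fun i hi j hj hij => ha hi hj ?_, ?_⟩
    · rwa [h1 i hi, h1 j hj] at hij
    · rwa [h3, Function.update_self]
  · rw [h2, image_insert_eq, h3, Function.update_self]

/-- The remaining elements may come in any order, but feasibility up to the horizon needs each of
them exactly once. -/
theorem runs_outputRest {s : State} (h1 : s.reg 1 = 1) (h2 : s.reg 2 = 0) (h0 : s.reg 0 = n)
    (hinj : InjOn (s.arr 1) (Iio (s.reg 12)))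
    (himage : s.arr 1 '' Iio (s.reg 12) = supp n (s.arr 3) \ supp n (s.arr 0)) :
    Runs M outputRest s (8 * n + 2) fun s' => ∃ l, s.reg 12 ≤ l ∧ InjOn (s'.arr 1) (Iio l) ∧
      s'.arr 1 '' Iio l = {x | x < n} \ supp n (s.arr 0) ∧
        ∀ j < s.reg 12, s'.arr 1 j = s.arr 1 j := by
  set A := supp n (s.arr 3) \ supp n (s.arr 0) with hA
  set R : ℕ → Set ℕ := fun k => {x | x < k ∧ s.arr 0 x = 0 ∧ s.arr 3 x = 0} with hR
  refine Runs.mono (T := 1 + (n * (7 + 1) + 1)) (P := fun s' => Agree [0, 1, 2] [0, 3] s s' ∧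
    s'.reg 5 = n ∧ s.reg 12 ≤ s'.reg 12 ∧ InjOn (s'.arr 1) (Iio (s'.reg 12)) ∧
      s'.arr 1 '' Iio (s'.reg 12) = A ∪ R n ∧ ∀ j < s.reg 12, s'.arr 1 j = s.arr 1 j) ?_ (by omega)
    ?_
  swap
  · rintro s' ⟨-, -, a3, a4, a5, a6⟩
    refine ⟨_, a3, a4, a5.trans ?_, a6⟩
    ext x
    simp only [hA, hR, supp, mem_union, mem_sdiff, mem_ofPred_eq]
    constructor
    · rintro (⟨⟨h1, h2⟩, h3⟩ | ⟨h1, h2, h3⟩)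
      · exact ⟨h1, h3⟩
      · exact ⟨h1, fun h4 => h4.2 h2⟩
    · rintro ⟨h1, h2⟩
      have h3 : s.arr 0 x = 0 := by
        by_contra h3
        exact h2 ⟨h1, h3⟩
      by_cases h4 : s.arr 3 x = 0
      · exact Or.inr ⟨h1, h3, h4⟩
      · exact Or.inl ⟨⟨h1, h4⟩, h2⟩
  refine (Runs.instr (Q := fun s' => s' = _) rfl le_rfl).seq fun s1 hs1 => ?_
  refine Runs.loop (Inv := fun k s' => Agree [0, 1, 2] [0, 3] s s' ∧
    s'.reg 5 = k ∧ s.reg 12 ≤ s'.reg 12 ∧ InjOn (s'.arr 1) (Iio (s'.reg 12)) ∧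
      s'.arr 1 '' Iio (s'.reg 12) = A ∪ R k ∧ ∀ j < s.reg 12, s'.arr 1 j = s.arr 1 j) ?_ ?_ ?_
  · rintro k hk s2 ⟨a1, a2, a3, a4, a5, a6⟩
    refine ⟨?_, ?_⟩
    · change s2.reg 5 < s2.reg 0
      rw [a2, a1.reg 0, h0]
      exact hk
    refine (Runs.block (T := 2) (Q := fun s' => Agree [0, 1, 2] [0, 3] s s' ∧ s'.reg 5 = k ∧
      s'.reg 12 = s2.reg 12 ∧ s'.arr 1 = s2.arr 1 ∧ s'.reg 10 = s.arr 0 k ∧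
      s'.reg 11 = s.arr 3 k) ?_ le_rfl).seq (U := 5) ?_
    · refine ⟨a1.trans (by simp [Agree, Instr.apply]), ?_⟩
      simp [Instr.apply, a2, a1.arr 0, a1.arr 3]
    rintro s3 ⟨b1, b2, b3, b4, b5, b6⟩
    have hsame : ¬ (s.arr 0 k = 0 ∧ s.arr 3 k = 0) → R (k + 1) = R k := by
      intro hne
      ext x
      simp only [hR, mem_ofPred_eq]
      constructor
      · rintro ⟨hx, hx'⟩
        refine ⟨lt_of_le_of_ne (Nat.le_of_lt_succ hx) ?_, hx'⟩
        rintro rfl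
        exact hne hx'
      · exact fun hx => ⟨hx.1.trans (Nat.lt_succ_self k), hx.2⟩
    refine (Runs.ite (T := 3) (Q := fun s' => Agree [0, 1, 2] [0, 3] s s' ∧
      s'.reg 5 = k ∧ s.reg 12 ≤ s'.reg 12 ∧ InjOn (s'.arr 1) (Iio (s'.reg 12)) ∧
      s'.arr 1 '' Iio (s'.reg 12) = A ∪ R (k + 1) ∧ ∀ j < s.reg 12, s'.arr 1 j = s.arr 1 j)
      (fun heq => Runs.ite (T := 2) (fun heq' => ?_) fun heq' => ?_) fun heq => ?_).seq (U := 1) ?_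
    · change s3.reg 10 = s3.reg 2 at heq
      change s3.reg 11 = s3.reg 2 at heq'
      rw [b5, b1.reg 2, h2] at heq
      rw [b6, b1.reg 2, h2] at heq'
      have hk' : k ∉ A ∪ R k := by
        rintro (hc | hc)
        · exact hc.1.2 heq'
        · exact lt_irrefl _ hc.1
      have hins : insert k (A ∪ R k) = A ∪ R (k + 1) := by
        rw [← union_insert]
        congr 1
        ext x
        simp only [hR, mem_insert_iff, mem_ofPred_eq]
        constructor
        · rintro (rfl | hx)
          · exact ⟨Nat.lt_succ_self _, heq, heq'⟩
          · exact ⟨hx.1.trans (Nat.lt_succ_self k), hx.2⟩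
        · rintro ⟨hx, hx'⟩
          rcases Nat.lt_succ_iff_lt_or_eq.1 hx with hlt | rfl
          · exact Or.inr ⟨hlt, hx'⟩
          · exact Or.inl rfl
      obtain ⟨c1, c2⟩ := injOn_image_update a4 a5 hk'
      refine Runs.block ⟨b1.trans (by simp [Agree, Instr.apply]), by simpa [Instr.apply] using b2,
        ?_, ?_, ?_, ?_⟩ le_rfl
      · simp [Instr.apply, b3]
        omega
      · simpa [Instr.apply, b1.reg 1, h1, b2, b3, b4] using c1
      · simpa [Instr.apply, b1.reg 1, h1, b2, b3, b4, hins] using c2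
      · intro j hj
        simp [Instr.apply, b2, b3, b4, (lt_of_lt_of_le hj a3).ne, a6 j hj]
    · change ¬ s3.reg 11 = s3.reg 2 at heq'
      rw [b6, b1.reg 2, h2] at heq'
      refine Runs.skip ⟨b1, b2, ?_⟩
      rw [b3, b4, hsame fun hc => heq' hc.2]
      exact ⟨a3, a4, a5, a6⟩
    · change ¬ s3.reg 10 = s3.reg 2 at heq
      rw [b5, b1.reg 2, h2] at heq
      refine Runs.skip ⟨b1, b2, ?_⟩
      rw [b3, b4, hsame fun hc => heq hc.1]
      exact ⟨a3, a4, a5, a6⟩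
    · rintro s4 ⟨c1, c2, c3, c4, c5, c6⟩
      exact Runs.instr ⟨c1.trans (by simp [Agree, Instr.apply]),
        by simp [Instr.apply, c2, c1.reg 1, h1], by simpa [Instr.apply] using c3,
        by simpa [Instr.apply] using c4, by simpa [Instr.apply] using c5,
        by simpa [Instr.apply] using c6⟩ le_rfl
  · rintro s' ⟨a1, a3, -⟩
    change ¬ s'.reg 5 < s'.reg 0
    rw [a3, a1.reg 0, h0]
    exact lt_irrefl _
  · subst hs1
    have hR0 : R 0 = ∅ := by ext x; simp [hR]
    refine ⟨by simp [Agree, Instr.apply], by simp [Instr.apply, h2], by simp [Instr.apply],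
      by simpa [Instr.apply] using hinj, by simpa [Instr.apply, hR0] using himage,
      by simp [Instr.apply]⟩

/-! ### The program -/

/-- The program that solves the incremental matroid design problem. -/
def design : Prog :=
  .seq (.instr (.const 1 1))
    (.seq copyWeights
      (.seq (.instr (.copy 3 0))
        (.seq mergeSort
          (.seq greedyAll
            (.seq greedyGiven
              (.seq exchangeAll
                (.seq outputSwaps outputRest)))))))

/-- A bound for the running time of `design` on a matroid of rank `r` with `n` elements. -/
def designTime (n r : ℕ) : ℕ :=
  1 + ((4 * n + 2) + (1 + (sortTime n + ((9 * n + 2) + ((9 * n + 2) +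
    ((r * (8 * r + 11) + 1) + ((sortTime r + 5 * r + 3) + (8 * n + 2))))))))

/-- Both `f_free` and `span` come from the greedy basis `S` of the whole matroid. Everything before
`f i` is spanned by elements of `S` other than `f i`, so `f i` cannot be spanned by it. An element
outside `G` and `S` is spanned by earlier elements of `S`, each of which is in `G` or is some `f j`.
-/
theorem isSwapSequence_of_greedy {α : Type*} {M : Matroid α} {pos : α → ℕ} {G X S : Set α}
    {e f : ℕ → α} {m : ℕ} (hpos : InjOn pos M.E) (hG : G ⊆ M.E) (hX : M.IsBase X)
    (hXG : IsGreedyBasis M pos G X) (hS : IsGreedyBasis M pos M.E S) (hf : f '' Iio m = S \ G)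
    (hmono : ∀ i j, i < j → j < m → pos (f i) < pos (f j))
    (hlast : ∀ i < m, IsLastSwap M pos X e f i) : IsSwapSequence M pos G X e f m where
  injOn_pos := hpos
  subset_ground := hG
  isBase := hX
  greedy := hXG
  f_notMem i hi := (hf.le ⟨i, hi, rfl⟩ : f i ∈ S \ G).2
  f_indep := hf ▸ hS.indep.sdiff G
  f_mono := hmono
  f_free i hi hc := by
    have hfS : f i ∈ S := (hf.le ⟨i, hi, rfl⟩ : f i ∈ S \ G).1
    refine hS.indep.notMem_closure_sdiff_of_mem hfS
      (M.closure_subset_closure_of_subset_closure (fun y hy => ?_) hc)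
    have hyE : y ∈ M.E := by
      rcases hy.1 with h1 | h1
      · exact hG h1
      · exact hS.subset (hf.le h1 : y ∈ S \ G).1
    refine M.closure_subset_closure ?_ (hS.span y hyE)
    rintro z ⟨hz, hzy⟩
    refine ⟨hz, ?_⟩
    rintro rfl
    exact absurd hy.2 (not_lt.2 hzy)
  span x hxE hxG hxf := by
    rw [hf] at hxf ⊢
    refine M.closure_subset_closure ?_ (hS.span x hxE)
    rintro z ⟨hz, hzx⟩
    refine ⟨?_, lt_of_le_of_ne hzx fun heq => ?_⟩
    · by_cases hzG : z ∈ G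
      · exact Or.inl hzG
      · exact Or.inr ⟨hz, hzG⟩
    · have : z = x := hpos (hS.subset hz) hxE heq
      subst this
      exact hxf ⟨hz, hxG⟩
  e_mem i hi := (hlast i hi).1
  e_indep i hi := (hlast i hi).2.1
  e_max i hi := (hlast i hi).2.2

open Classical in
-- One list serves all `k`: its first `k` entries are compared with every basis that has at most `k`
-- elements outside `G`, whatever those elements are.
theorem runs_design (hM : M.E = univ) {s : State} (h0 : s.reg 0 = n)
    (hreg : ∀ i, i ≠ 0 → s.reg i = 0) (harr : ∀ a, a ≠ 0 → s.arr a = fun _ => 0) {B : Set ℕ}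
    (hB : (natMatroid M).IsBase B) (hBG : B ⊆ supp n (s.arr 0)) :
    Runs M design s (designTime n M.eRank.toNat) fun s' => ∃ l, InjOn (s'.arr 1) (Iio l) ∧
      s'.arr 1 '' Iio l = {x | x < n} \ supp n (s.arr 0) ∧
        ∀ k ≤ l, ∀ Z : Finset ℕ, (natMatroid M).IsBase (Z : Set ℕ) →
          (Z.filter fun x => x ∉ supp n (s.arr 0)).card ≤ k →
            ∃ Y : Finset ℕ, (natMatroid M).IsBase (Y : Set ℕ) ∧
              (Y : Set ℕ) ⊆ supp n (s.arr 0) ∪ s'.arr 1 '' Iio k ∧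
                ∑ x ∈ Y, s.rarr 0 x ≤ ∑ x ∈ Z, s.rarr 0 x := by
  set N := natMatroid M with hN
  set G := supp n (s.arr 0) with hGdef
  set w := s.rarr 0 with hwdef
  set r := M.eRank.toNat with hr
  have hE : N.E = {x | x < n} := natMatroid_ground hM
  have hG : G ⊆ N.E := hE ▸ fun x hx => hx.1
  refine (Runs.instr (Q := fun s' => Agree [0, 2, 12, 13, 14] [0, 3, 4] s s' ∧ s'.rarr = s.rarr ∧
    s'.reg 1 = 1) (by simp [Agree, Instr.apply]) le_rfl).seq ?_
  rintro s1 ⟨a1, a2, a3⟩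
  have a4 : s1.reg 2 = 0 := (a1.reg 2).trans (hreg 2 (by norm_num))
  have a5 : s1.reg 0 = n := (a1.reg 0).trans h0
  have hrun := runs_copyWeights (M := M) a3 a4
  rw [a5] at hrun
  refine hrun.seq ?_
  rintro s2 ⟨b1, b2, b3⟩
  refine (Runs.instr (Q := fun s' => Agree [0, 1, 2, 12, 13, 14] [0, 3, 4] s2 s' ∧
    s'.rarr = s2.rarr ∧ s'.reg 3 = n)
    (by simp [Agree, Instr.apply, b1.reg 0, a5]) le_rfl).seq ?_
  rintro s3 ⟨c1, c2, c3⟩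
  have hrun := runs_mergeSort (M := M) ((c1.reg 1).trans ((b1.reg 1).trans a3))
    ((c1.reg 2).trans ((b1.reg 2).trans a4))
  rw [c3] at hrun
  refine hrun.seq (T := sortTime n) ?_
  rintro s4 ⟨d1, d2, d3⟩
  obtain ⟨pos, hpos⟩ := d3.exists_isRanking
  have e0 : s4.reg 0 = n := (d1.reg 0).trans ((c1.reg 0).trans ((b1.reg 0).trans a5))
  have e1 : s4.reg 1 = 1 := (d1.reg 1).trans ((c1.reg 1).trans ((b1.reg 1).trans a3))
  have e2 : s4.reg 2 = 0 := (d1.reg 2).trans ((c1.reg 2).trans ((b1.reg 2).trans a4))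
  have e12 : s4.reg 12 = 0 := (d1.reg 12).trans ((c1.reg 12).trans ((b1.reg 12).trans
    ((a1.reg 12).trans (hreg 12 (by norm_num)))))
  have e13 : s4.reg 13 = 0 := (d1.reg 13).trans ((c1.reg 13).trans ((b1.reg 13).trans
    ((a1.reg 13).trans (hreg 13 (by norm_num)))))
  have e14 : s4.reg 14 = 0 := (d1.reg 14).trans ((c1.reg 14).trans ((b1.reg 14).trans
    ((a1.reg 14).trans (hreg 14 (by norm_num)))))
  have f0 : s4.arr 0 = s.arr 0 :=
    (d1.arr 0).trans ((c1.arr 0).trans ((b1.arr 0).trans (a1.arr 0)))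
  have f3 : s4.arr 3 = fun _ => 0 := (d1.arr 3).trans ((c1.arr 3).trans ((b1.arr 3).trans
    ((a1.arr 3).trans (harr 3 (by norm_num)))))
  have f4 : s4.arr 4 = fun _ => 0 := (d1.arr 4).trans ((c1.arr 4).trans ((b1.arr 4).trans
    ((a1.arr 4).trans (harr 4 (by norm_num)))))
  have g0 : s4.rarr 0 = w := by rw [d2, c2, b2, a2]
  have hw : ∀ x ∈ N.E, ∀ y ∈ N.E, pos x ≤ pos y → w x ≤ w y := by
    intro x hx y hy hxy
    rw [hE] at hx hy
    have h1 := d3.mono _ _ hxy (hpos.pos_lt y hy)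
    rwa [hpos.apply_pos x hx, hpos.apply_pos y hy, c2, b3 x (a5.symm ▸ hx), b3 y (a5.symm ▸ hy),
      a2] at h1
  refine (runs_greedyAll hM e0 e1 e2 e12 (fun x => by rw [f3]) hpos).seq ?_
  rintro s5 ⟨i1, i2, i3, i4⟩
  rw [f0] at i4
  refine (runs_greedyGiven hM ((i1.reg 0).trans e0) ((i1.reg 1).trans e1) ((i1.reg 2).trans e2)
    ((i1.reg 13).trans e13) (fun x => by rw [i1.arr 4, f4]) ((i1.arr 2).symm ▸ hpos)).seq ?_
  rintro s6 ⟨j1, j2, j3, j4⟩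
  rw [i1.arr 0, f0] at j3
  rw [← j1.arr 6, ← j1.reg 12, ← j1.arr 3] at i4
  rw [← j1.arr 3, ← hE] at i3
  -- The greedy basis of `G` spans `G`, which contains a basis of the matroid.
  have hbase : N.IsBase (supp n (s6.arr 4)) := by
    refine j3.indep.isBase_of_ground_subset_closure ?_
    rw [← hB.closure_eq]
    refine N.closure_subset_closure_of_subset_closure fun x hx => ?_
    exact N.closure_subset_closure (fun y hy => hy.1) (j3.span x (hBG hx))
  have hfind : N.Indep (s6.arr 6 '' Iio (s6.reg 12)) := by
    rw [i4.image]
    exact i3.indep.sdiff _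
  have hmr : s6.reg 12 ≤ r := i4.le_eRank (i3.indep.sdiff _)
  have hrr : s6.reg 13 ≤ r := j4.le_eRank j3.indep
  have k1 : s6.reg 1 = 1 := (j1.reg 1).trans ((i1.reg 1).trans e1)
  have k2 : s6.reg 2 = 0 := (j1.reg 2).trans ((i1.reg 2).trans e2)
  have hrun := runs_exchangeAll hM k1 k2 ((j1.reg 14).trans ((i1.reg 14).trans e14)) j4 hbase hfind
    (fun i hi hc => (i4.mem hi).2 (j3.subset hc)) i4.injOn
  refine (hrun.mono (U := r * (8 * r + 11) + 1) (by gcongr) fun _ => id).seq ?_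
  rintro s7 ⟨l1, e, l2, l3⟩
  have hrun := runs_outputSwaps (M := M) ((l1.reg 1).trans k1) ((l1.reg 2).trans k2)
  rw [l1.reg 12] at hrun
  refine (hrun.mono (U := sortTime r + 5 * r + 3) (by
    have := sortTime_mono hmr
    omega) fun _ => id).seq ?_
  rintro s8 ⟨m1, σ, m2, m3⟩
  rw [l1.arr 6] at m3
  set m := s6.reg 12 with hm
  set f := s6.arr 6 with hfdef
  have n12 : s8.reg 12 = m := (m1.reg 12).trans (l1.reg 12)
  have n0 : s8.arr 0 = s.arr 0 :=
    (m1.arr 0).trans ((l1.arr 0).trans ((j1.arr 0).trans ((i1.arr 0).trans f0)))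
  have n3 : s8.arr 3 = s6.arr 3 := (m1.arr 3).trans (l1.arr 3)
  have himage : s8.arr 1 '' Iio m = f '' Iio m := by
    ext x
    constructor
    · rintro ⟨j, hj, rfl⟩
      exact ⟨σ j, m2.lt j hj, (m3 j hj).symm⟩
    · rintro ⟨i, hi, rfl⟩
      obtain ⟨j, hj, rfl⟩ := m2.surj i hi
      exact ⟨j, hj, m3 j hj⟩
  have hrun := runs_outputRest (M := M) (s := s8) ((m1.reg 1).trans ((l1.reg 1).trans k1))
    ((m1.reg 2).trans ((l1.reg 2).trans k2))
    ((m1.reg 0).trans ((l1.reg 0).trans ((j1.reg 0).trans ((i1.reg 0).trans e0))))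
    (by
      rw [n12]
      intro i hi j hj hij
      rw [m3 i hi, m3 j hj] at hij
      exact m2.injOn hi hj (i4.injOn (m2.lt i hi) (m2.lt j hj) hij))
    (by rw [n12, himage, i4.image, n3, n0])
  rw [n12, n0] at hrun
  refine hrun.mono le_rfl ?_
  rintro s9 ⟨l, p1, p2, p3, p4⟩
  refine ⟨l, p2, p3, fun k hk Z hZ hZk => ?_⟩
  set X : Finset ℕ := (Finset.range n).filter fun x => s6.arr 4 x ≠ 0 with hX
  have hXcoe : (X : Set ℕ) = supp n (s6.arr 4) := by ext x; simp [hX, supp]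
  have hswap : IsSwapSequence N pos G X e f m := by
    rw [hXcoe]
    exact isSwapSequence_of_greedy (hE ▸ hpos.injOn) hG hbase j3 i3 i4.image i4.mono l2
  have hgain : ∀ i < m, s7.rarr 1 i = - IsSwapSequence.gain w e f i := fun i hi => by
    rw [l3 i hi, j2, i2, g0, IsSwapSequence.gain]
    ring
  have : N.Finite := ⟨hE ▸ finite_Iio n⟩
  obtain ⟨Y, hY, hYsub, hYw⟩ := hswap.exists_isBase_sum_le hw m2.lt m2.injOn
    (fun i j hij hj => by
      have := m2.mono i j hij hj
      rw [hgain _ (m2.lt i (lt_of_le_of_lt hij hj)), hgain _ (m2.lt j hj)] at this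
      exact neg_le_neg_iff.1 this) k hZ hZk
  refine ⟨Y, hY, hYsub.trans (union_subset_union_right _ ?_), hYw⟩
  rintro x ⟨j, hjm, hjk, rfl⟩
  exact ⟨j, hjk, by rw [p4 j hjm, m3 j hjm]⟩

/-! ### From the output list to an optimal solution -/

theorem supp_inputState (E₀ : Finset (Fin n)) (w : Fin n → ℝ) :
    supp n ((inputState E₀ w).arr 0) = Fin.val '' (E₀ : Set (Fin n)) := by
  ext x
  simp only [supp, inputState, mem_ofPred_eq, true_and, mem_image, Finset.mem_coe]
  constructor
  · rintro ⟨-, hx⟩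
    by_contra hc
    exact hx (if_neg hc)
  · rintro ⟨e, he, rfl⟩
    exact ⟨e.2, by rw [if_pos ⟨e, he, rfl⟩]; norm_num⟩

/-- The basis inside `E₀` makes the set of weights for `B` nonempty, so that its infimum is not the
default value of `sInf`; finiteness makes the set for `A` bounded below. -/
theorem minBaseWeight_le (E₀ : Finset (Fin n)) (w : Fin n → ℝ) {A B : Finset (Fin n)}
    (hE₀ : ∃ B : Set (Fin n), M.IsBase B ∧ B ⊆ (E₀ : Set (Fin n)))
    (h : ∀ Z : Finset (Fin n), M.IsBase (Z : Set (Fin n)) → Z ⊆ E₀ ∪ B →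
      ∃ Y : Finset (Fin n), M.IsBase (Y : Set (Fin n)) ∧ Y ⊆ E₀ ∪ A ∧
        ∑ x ∈ Y, w x ≤ ∑ x ∈ Z, w x) :
    minBaseWeight M E₀ w A ≤ minBaseWeight M E₀ w B := by
  obtain ⟨B₀, hB₀, hsub⟩ := hE₀
  have hfin : {c : ℝ | ∃ X : Finset (Fin n), M.IsBase (X : Set (Fin n)) ∧ X ⊆ E₀ ∪ A ∧
      c = ∑ x ∈ X, w x}.Finite :=
    (finite_range fun X : Finset (Fin n) => ∑ x ∈ X, w x).subset
      fun c ⟨X, _, _, hc⟩ => ⟨X, hc.symm⟩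
  refine le_csInf ⟨_, B₀.toFinite.toFinset, by simpa using hB₀, ?_, rfl⟩ ?_
  · intro x hx
    exact Finset.mem_union_left _ (hsub (by simpa using hx))
  · rintro c ⟨Z, hZ, hZsub, rfl⟩
    obtain ⟨Y, hY, hYsub, hYw⟩ := h Z hZ hZsub
    exact (csInf_le hfin.bddBelow ⟨Y, hY, hYsub, rfl⟩).trans hYw

/-- Feasible sequences need not be nested, since elements may be dropped; the bound on the size is
all that optimality needs. -/
theorem Feasible.card_le {α : Type*} [DecidableEq α] {M : Matroid α} {E₀ : Finset α}
    {A : ℕ → Finset α} (h : Feasible M E₀ A) {i : ℕ} (hi : i ≤ horizon M E₀) :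
    (A i).card ≤ i := by
  induction i with
  | zero => simp [h.2.1]
  | succ i ih =>
    have h1 := ih (by omega)
    have h2 := h.2.2 i hi
    have h3 := Finset.card_le_card_sdiff_add_card (s := A (i + 1)) (t := A i)
    omega

/-- A list of the elements outside `E₀` whose initial segments allow the cheapest bases is an
optimal solution. -/
theorem isOptimalSolution_of_list (hM : M.E = univ) {E₀ : Finset (Fin n)} {w : Fin n → ℝ}
    (hE₀ : ∃ B : Set (Fin n), M.IsBase B ∧ B ⊆ (E₀ : Set (Fin n))) {s : State} {l : ℕ}
    (hinj : InjOn (s.arr 1) (Iio l))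
    (himage : s.arr 1 '' Iio l = {x | x < n} \ Fin.val '' (E₀ : Set (Fin n)))
    (hopt : ∀ k ≤ l, ∀ Z : Finset (Fin n), M.IsBase (Z : Set (Fin n)) → (Z \ E₀).card ≤ k →
      ∃ Y : Finset (Fin n), M.IsBase (Y : Set (Fin n)) ∧ Y ⊆ E₀ ∪ outputSets s k ∧
        ∑ x ∈ Y, w x ≤ ∑ x ∈ Z, w x) :
    IsOptimalSolution M E₀ w (outputSets s) := by
  have hmem : ∀ j < l, ∃ e : Fin n, s.arr 1 j = e ∧ e ∉ E₀ := by
    intro j hj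
    have h1 : s.arr 1 j ∈ {x | x < n} \ Fin.val '' (E₀ : Set (Fin n)) := himage ▸ ⟨j, hj, rfl⟩
    exact ⟨⟨s.arr 1 j, h1.1⟩, rfl, fun hc => h1.2 ⟨_, hc, rfl⟩⟩
  -- The list has no repetition and covers the complement of `E₀`, so its length is the horizon.
  have hhor : horizon M E₀ = l := by
    have h1 : Fin.val '' (M.E \ (E₀ : Set (Fin n))) = s.arr 1 '' Iio l := by
      rw [himage, image_sdiff Fin.val_injective, hM, image_univ, Fin.range_val]
      rfl
    rw [horizon, ← ncard_image_of_injective _ Fin.val_injective, h1, hinj.ncard_image,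
      ← Finset.coe_Iio, ncard_coe_finset, Nat.card_Iio]
  refine ⟨⟨fun i hi e he => ?_, ?_, fun i hi => ?_⟩, fun B hB => ?_⟩
  · obtain ⟨j, hj, hje⟩ := (Finset.mem_filter.1 (Finset.mem_coe.1 he)).2
    obtain ⟨e', he', heE⟩ := hmem j (by omega)
    rw [Fin.ext (hje.symm.trans he')]
    exact ⟨hM ▸ mem_univ _, heE⟩
  · ext e
    simp [outputSets]
  · obtain ⟨e, he, -⟩ := hmem i (by omega)
    rw [Finset.card_eq_one]
    refine ⟨e, ?_⟩
    ext x
    simp only [outputSets, Finset.mem_sdiff, Finset.mem_filter, Finset.mem_univ, true_and,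
      Finset.mem_singleton]
    constructor
    · rintro ⟨⟨j, hj, hjx⟩, hx⟩
      have hji : j = i := by
        by_contra hne
        exact hx ⟨j, by omega, hjx⟩
      rw [hji, he] at hjx
      exact (Fin.ext hjx).symm
    · rintro rfl
      refine ⟨⟨i, Nat.lt_succ_self i, he⟩, ?_⟩
      rintro ⟨j, hj, hjx⟩
      exact hj.ne (hinj (mem_Iio.2 (by omega)) (mem_Iio.2 (by omega)) (hjx.trans he.symm))
  -- The comparison is made term by term: a basis available to the competitor at time `i` has at
  -- most `i` elements outside `E₀`.
  · refine Finset.sum_le_sum fun i hi => minBaseWeight_le E₀ w hE₀ fun Z hZ hZsub => ?_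
    have hi' : i ≤ horizon M E₀ := Nat.lt_succ_iff.1 (Finset.mem_range.1 hi)
    refine hopt i (hhor ▸ hi') Z hZ (le_trans (Finset.card_le_card fun x hx => ?_) (hB.card_le hi'))
    rw [Finset.mem_sdiff] at hx
    exact (Finset.mem_union.1 (hZsub hx.1)).resolve_left hx.2

theorem runs_design_inputState (hM : M.E = univ) (E₀ : Finset (Fin n)) (w : Fin n → ℝ)
    (hE₀ : ∃ B : Set (Fin n), M.IsBase B ∧ B ⊆ (E₀ : Set (Fin n))) :
    Runs M design (inputState E₀ w) (designTime n M.eRank.toNat) fun s' =>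
      IsOptimalSolution M E₀ w (outputSets s') := by
  classical
  obtain ⟨B, hB, hBE⟩ := hE₀
  have hG := supp_inputState E₀ w
  refine (runs_design (B := Fin.val '' B) hM rfl (fun i hi => if_neg hi)
    (fun a ha => funext fun i => if_neg fun hc => ha hc.1) (hB.mapEmbedding Fin.valEmbedding) ?_).mono
    le_rfl ?_
  · rw [hG]
    exact image_mono hBE
  rintro s ⟨l, h1, h2, h3⟩
  rw [hG] at h2
  refine isOptimalSolution_of_list hM ⟨B, hB, hBE⟩ h1 h2 fun k hk Z hZ hZk => ?_
  have hw : ∀ x : Fin n, (inputState E₀ w).rarr 0 x = w x := fun x => by simp [inputState]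
  have hE₀val : ∀ x : Fin n, (x : ℕ) ∈ supp n ((inputState E₀ w).arr 0) ↔ x ∈ E₀ := fun x => by
    rw [hG, Fin.val_injective.mem_set_image, Finset.mem_coe]
  obtain ⟨Y, hY, hYsub, hYw⟩ := h3 k hk (Z.map Fin.valEmbedding)
    (by
      rw [Finset.coe_map]
      exact hZ.mapEmbedding _)
    (by
      refine le_trans (le_of_eq ?_) hZk
      rw [Finset.filter_map, Finset.card_map]
      congr 1
      ext x
      simp [hE₀val])
  rw [natMatroid, Matroid.mapEmbedding_isBase_iff] at hY
  set Y' : Finset (Fin n) := Finset.univ.filter fun x => (x : ℕ) ∈ Y with hY'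
  have hmap : Y'.map Fin.valEmbedding = Y := by
    ext x
    simp only [hY', Finset.mem_map, Finset.mem_filter, Finset.mem_univ, true_and]
    constructor
    · rintro ⟨y, hy, rfl⟩
      exact hy
    · intro hx
      obtain ⟨y, rfl⟩ := hY.2 hx
      exact ⟨y, hx, rfl⟩
  refine ⟨Y', ?_, fun x hx => ?_, ?_⟩
  · convert hY.1
    ext x
    simp [hY']
  · rw [hY', Finset.mem_filter] at hx
    rcases hYsub hx.2 with h4 | ⟨j, hj, hjx⟩
    · exact Finset.mem_union_left _ ((hE₀val x).1 h4)
    · exact Finset.mem_union_right _ (Finset.mem_filter.2 ⟨Finset.mem_univ _, j, hj, hjx⟩)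
  · rw [← hmap, Finset.sum_map, Finset.sum_map] at hYw
    simpa [hw] using hYw

/-! ### The running time as a real estimate -/

/-- For `n > 1`, the power of two with exponent `Nat.clog 2 n - 1` is below `n`, and `log 2 ≥ 1/2`.
-/
theorem clog_le_log (n : ℕ) (hn : 1 ≤ n) : (Nat.clog 2 n : ℝ) ≤ 2 * Real.log n + 1 := by
  have hlog : 0 ≤ Real.log n := Real.log_natCast_nonneg n
  rcases hn.eq_or_lt with rfl | hlt
  · simp
  · obtain ⟨k, hk⟩ : ∃ k, Nat.clog 2 n = k + 1 :=
      Nat.exists_eq_succ_of_ne_zero (Nat.clog_pos (by norm_num) hlt).ne'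
    have h1 : 2 ^ k < n := (Nat.lt_clog_iff_pow_lt (by norm_num)).1 (by omega)
    have h2 : (2 : ℝ) ^ k ≤ n := by exact_mod_cast h1.le
    have h3 := Real.log_le_log (by positivity) h2
    rw [Real.log_pow] at h3
    have h4 : (1 / 2 : ℝ) ≤ Real.log 2 := by linarith [Real.log_two_gt_d9]
    have h5 : (k : ℝ) * (1 / 2) ≤ k * Real.log 2 := by gcongr
    rw [hk]
    push_cast
    linarith

/-- Since `r ≤ n`, both sorts are bounded by the one of length `n`, and the terms linear in `r` are
absorbed by `n`. Only the exchanges contribute `r ^ 2`. The constant `500` is generous. -/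
theorem designTime_le (n r : ℕ) (hr : r ≤ n) :
    (designTime n r : ℝ) ≤
      500 * max 1 (max ((n : ℝ) + (r : ℝ) ^ 2) ((n : ℝ) * Real.log n)) := by
  have h1 := sortTime_mono hr
  set V := max 1 (max ((n : ℝ) + (r : ℝ) ^ 2) ((n : ℝ) * Real.log n)) with hV
  have hV1 : 1 ≤ V := le_max_left _ _
  have hV2 : (n : ℝ) + (r : ℝ) ^ 2 ≤ V := (le_max_left _ _).trans (le_max_right _ _)
  have hV3 : (n : ℝ) * Real.log n ≤ V := (le_max_right _ _).trans (le_max_right _ _)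
  have hr2 : 0 ≤ (r : ℝ) ^ 2 := sq_nonneg _
  have hclog : (Nat.clog 2 n : ℝ) * (26 * n + 10) ≤ 72 * (n * Real.log n) + 36 * n := by
    rcases Nat.eq_zero_or_pos n with rfl | hn
    · simp
    · have h2 := clog_le_log n hn
      have h3 : (1 : ℝ) ≤ n := by exact_mod_cast hn
      calc (Nat.clog 2 n : ℝ) * (26 * n + 10) ≤ (2 * Real.log n + 1) * (36 * n) := by
            gcongr
            · have := Real.log_natCast_nonneg n
              linarith
        _ = _ := by ring
  have hsort : (sortTime n : ℝ) ≤ 72 * (n * Real.log n) + 39 * n + 4 := by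
    rw [sortTime]
    push_cast
    linarith
  have hsort' : (sortTime r : ℝ) ≤ sortTime n := by exact_mod_cast h1
  have hrn : (r : ℝ) ≤ n := by exact_mod_cast hr
  rw [designTime]
  push_cast
  nlinarith

end IMD

theorem theorem3 :
    ∃ (p : IMD.Prog) (C : ℝ), ∀ (n : ℕ) (M : Matroid (Fin n)), M.E = Set.univ →
      ∀ (E₀ : Finset (Fin n)) (w : Fin n → ℝ),
        (∃ B : Set (Fin n), M.IsBase B ∧ B ⊆ (E₀ : Set (Fin n))) →
        ∃ (t : ℕ) (s : IMD.State),
          IMD.Exec M p (IMD.inputState E₀ w) t s ∧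
          IMD.IsOptimalSolution M E₀ w (IMD.outputSets s) ∧
          (t : ℝ) ≤ C * max 1 (max ((n : ℝ) + (M.eRank.toNat : ℝ) ^ 2) ((n : ℝ) * Real.log n)) := by
  refine ⟨IMD.design, 500, fun n M hM E₀ w hE₀ => ?_⟩
  obtain ⟨t, s, hexec, ht, hopt⟩ := IMD.runs_design_inputState hM E₀ w hE₀
  have hrank : M.eRank.toNat ≤ n := by
    have h1 := M.eRank_le_encard_ground
    rw [hM, Set.encard_univ] at h1
    simpa using ENat.toNat_le_toNat h1 (by simp)
  exact ⟨t, s, hexec, hopt, (Nat.cast_le.2 ht).trans (IMD.designTime_le n _ hrank)⟩
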